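/- **Model.** A network is a connected undirected graph $G=(V,E)$ with $n=|V|\ge 1$ vertices and maximum degree $\Delta$; an anonymous device sits at each vertex. The devices know nothing about $G$ except $n$ and $\Delta$; they all run the same algorithm, local computation is free, and each device has private independent uniformly random bits. Time is partitioned into slots, and all devices agree on slot zero. In each slot each device either sends a message (a finite bit string of any length), listens, or remains idle; sending and listening cost one unit of energy each, idling is free. A device that sends or idles gets no feedback. In the $\mathsf{LOCAL}$ model a listener hears every message sent by its neighbors. In the $\mathsf{CD}$ and $\mathsf{No\text{-}CD}$ models a listener receives a message if exactly one neighbor sends; if no neighbor sends it hears silence; if at least two neighbors send it hears noise in $\mathsf{CD}$ and silence in $\mathsf{No\text{-}CD}$. In the $\mathsf{Broadcast}$ problem a source $s\in V$ initially holds a message $m$ (each device knows whether it is the source), and at the end of the computation all devices have to know $m$. **Theorem.** In each of the three models, for every constant $c\in\mathbb N$ there are a constant $C>0$ (depending only on $c$) and a randomized algorithm that, on every connected network, for every source $s$ and every message $m$, solves $\mathsf{Broadcast}$ with probability at least $1-n^{-c}$, always within at most $C\cdot T(n,\Delta)$ time slots and with at most $C\cdot E(n,\Delta)$ energy spent by each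 device, where $$\begin{array}{lll} \mathsf{LOCAL}: & T(n,\Delta)=n\log n, & E(n,\Delta)=\log n,\\ \mathsf{CD}: & T(n,\Delta)=n\log(\Delta+1)\log^2 n, & E(n,\Delta)=\log^2 n,\\ \mathsf{No\text{-}CD}: & T(n,\Delta)=n\log(\Delta+1)\log^2 n, & E(n,\Delta)=\log(\Delta+1)\log^2 n. \end{array}$$ Since $\log(\Delta+1)\le 2\log\Delta$ when $\Delta\ge 2$, that is, when $n\ge 3$, these are the bounds $O(n\log n)$, $O(n\log\Delta\log^2 n)$, $O(n\log\Delta\log^2 n)$ on time and $O(\log n)$, $O(\log^2 n)$, $O(\log\Delta\log^2 n)$ on energy. -/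

import Mathlib

namespace RadioNetwork

/-- Messages are finite bit strings of arbitrary length. -/
abbrev Msg : Type := List Bool

/-- The three communication models. -/
inductive Model where
  | LOCAL
  | CD
  | NoCD

/-- What a device can do in one time slot: send a message, listen, or remain idle. -/
inductive Action where
  | send (msg : Msg)
  | listen
  | idle

/-- What a listening device can hear in one time slot. In the `LOCAL` model a listener
hears the multiset of all the messages sent by its neighbors (`all`); in the other two models
it hears one message, silence, or noise. -/
inductive Signal where
  | all (msgs : Multiset Msg)
  | message (msg : Msg)
  | silence
  | noise

/-- The message sent by an action, if any. -/
def Action.sent : Action → Option Msg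
  | .send msg => some msg
  | .listen => none
  | .idle => none

open Classical in
/-- The signal heard by a listener whose transmitting neighbors send the messages `inc`
(one message for each transmitting neighbor). -/
noncomputable def hear (M : Model) (inc : Multiset Msg) : Signal :=
  match M with
  | .LOCAL => .all inc
  | .CD =>
      if h : ∃ msg, inc = {msg} then .message h.choose
      else if inc = 0 then .silence
      else .noise
  | .NoCD =>
      if h : ∃ msg, inc = {msg} then .message h.choose
      else .silence

/-- A randomized protocol, to be run by every device of an anonymous network. All devices run the
same code; a device sees its own input (`some m` if it is the source, which holds `m`, and `none`
otherwise), its own private string of `coins` random bits, the number of the current time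
slot, and the feedback of the slots so far. The protocol runs for `slots` time slots, after which
each device has an output. Local computation is free and unrestricted. -/
structure Protocol where
  /-- number of private random bits of each device -/
  coins : ℕ
  /-- running time: the number of time slots -/
  slots : ℕ
  /-- local states of a device -/
  State : Type
  /-- the state at time slot zero, from the input and the private random bits -/
  start : Option Msg → (Fin coins → Bool) → State
  /-- the action in a given time slot -/
  act : ℕ → State → Action
  /-- the state after a given time slot; the feedback is `none` if the device did not listen -/
  next : ℕ → State → Option Signal → State
  /-- the message that the device claims to know at the end, if any -/
  output : State → Option Msg

/-- The messages sent by the neighbors of `v`, one for each transmitting neighbor. -/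
def incoming {V : Type*} [Fintype V] (G : SimpleGraph V) [DecidableRel G.Adj]
    (a : V → Action) (v : V) : Multiset Msg :=
  (G.neighborFinset v).val.filterMap (fun w => (a w).sent)

/-- The feedback to `v` when each device `w` does `a w`: only a listener gets feedback. -/
noncomputable def feedback {V : Type*} [Fintype V] (M : Model) (G : SimpleGraph V)
    [DecidableRel G.Adj] (a : V → Action) (v : V) : Option Signal :=
  match a v with
  | .send _ => none
  | .listen => some (hear M (incoming G a v))
  | .idle => none

namespace Protocol

variable {V : Type*} [Fintype V] [DecidableEq V]

/-- The states of all devices after `t` slots, if `s` is the source, `m` is its message, and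
`r v` are the random bits of `v`. -/
noncomputable def run (P : Protocol) (M : Model) (G : SimpleGraph V) [DecidableRel G.Adj]
    (s : V) (m : Msg) (r : V → Fin P.coins → Bool) : ℕ → V → P.State
  | 0 => fun v => P.start (if v = s then some m else none) (r v)
  | t + 1 => fun v =>
      P.next t (P.run M G s m r t v)
        (feedback M G (fun w => P.act t (P.run M G s m r t w)) v)

/-- The energy spent by `v`: the number of slots in which it sends or listens. -/
noncomputable def energy (P : Protocol) (M : Model) (G : SimpleGraph V) [DecidableRel G.Adj]
    (s : V) (m : Msg) (r : V → Fin P.coins → Bool) (v : V) : ℕ :=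
  {t : ℕ | t < P.slots ∧ P.act t (P.run M G s m r t v) ≠ Action.idle}.ncard

/-- At the end of the computation, every device knows the message of the source. -/
def Succeeds (P : Protocol) (M : Model) (G : SimpleGraph V) [DecidableRel G.Adj]
    (s : V) (m : Msg) (r : V → Fin P.coins → Bool) : Prop :=
  ∀ v, P.output (P.run M G s m r P.slots v) = some m

/-- The probability that every device knows the message at the end, when the
random bits of the devices are independent and uniform. -/
noncomputable def successProb (P : Protocol) (M : Model) (G : SimpleGraph V) [DecidableRel G.Adj]
    (s : V) (m : Msg) : ℝ :=
  (Nat.card {r : V → Fin P.coins → Bool // P.Succeeds M G s m r} : ℝ) /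
    (Nat.card (V → Fin P.coins → Bool) : ℝ)

end Protocol

/-- In the model `M`, broadcast can be solved by a randomized algorithm with high probability in
time `O(T n Δ)` and energy `O(E n Δ)`: for every exponent `c` there are a constant `C` and an
algorithm `A`, which is given only the number `n` of devices and the maximum degree `Δ`,
such that on every connected network, for every source `s` and message `m`, the algorithm takes
at most `C * T n Δ` slots, each device spends at most `C * E n Δ` energy,
and all devices know `m` at the end with probability at least `1 - 1 / n ^ c`. -/
def BroadcastWHP (M : Model) (T E : ℕ → ℕ → ℝ) : Prop :=
  ∀ c : ℕ, ∃ C : ℝ, 0 < C ∧ ∃ A : ℕ → ℕ → Protocol,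
    ∀ (V : Type) [Fintype V] [DecidableEq V] (G : SimpleGraph V) [DecidableRel G.Adj],
      G.Connected → ∀ (s : V) (m : Msg) (n Δ : ℕ), n = Fintype.card V → Δ = G.maxDegree →
        ((A n Δ).slots : ℝ) ≤ C * T n Δ ∧
        (∀ (r : V → Fin (A n Δ).coins → Bool) (v : V),
          ((A n Δ).energy M G s m r v : ℝ) ≤ C * E n Δ) ∧
        1 - 1 / (n : ℝ) ^ c ≤ (A n Δ).successProb M G s m

end RadioNetwork

set_option linter.unusedSectionVars false

/-! The devices maintain a good labeling: every nonzero label has a neighbor whose label is smaller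
by one, so every vertex descends from a root, a vertex labeled 0. With a single root left, a message
climbs layer by layer from the source to the root and then descends to everyone. Such a pass takes
`n` blocks, but a device is awake only when its own layer is due: at most seven blocks of a phase
(`card_active_le`).

At first all devices are roots. In each phase every root tosses a coin, and the roots with `true`
start a wave that goes down to their descendants, across one edge, up the layers and down again.
Registers count hops in unary, and a device that is reached takes its hop count as its new label.
The new labeling is good (`IsPhase.good`), and a root with `false` linked to a root with `true`
stops being a root (`IsPhase.not_root`). By connectivity, while there are two roots each is linked
to another (`GoodLabeling.exists_linked`), so each disappears with probability at least 1/4. Hence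
`O(log n)` phases leave one root with high probability (`expect_excess_le`).

A block is carried out by a relay, which must bring a message to each receiver with a sending
neighbor. `Relay.Works` asks for a potential, at least 1 while nothing is received, that contracts
by `κ` in expectation per round; so `R` rounds fail with probability at most `κ ^ R * F`, and a
union bound over blocks and devices finishes (`le_successProb`). In `LOCAL` one slot suffices.
Otherwise a sender picks slot `j` with probability `2^-(j+1)`, so that with `k` senders slot `⌊log₂
k⌋` is used exactly once with probability at least 1/8. Without collision detection a receiver
listens in all `⌊log₂ Δ⌋ + 1` slots. With it, a receiver listens in one slot per round and searches
for the right one, moving up after noise and down after silence; `(9/8)` to the distance from `⌊log₂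
k⌋` is the potential (`walkRelay_works`). -/

namespace RadioNetwork

open Finset
open scoped BigOperators

/-! ### Averages over finite product spaces -/

section Averages

variable {ι α : Type*} [Fintype ι] [DecidableEq ι] [Fintype α]

/-- Resampling one coordinate does not change an average over a product space. -/
theorem expect_resample [Nonempty α] (q : ι) (F : (ι → α) → ℝ) :
    (𝔼 ω, F ω) = 𝔼 ω : ι → α, 𝔼 a, F (Function.update ω q a) := by
  -- Exchanging the coordinate `ω q` with an independent value is an involution, so it preserves the
  -- uniform average.
  let e : (ι → α) × α ≃ (ι → α) × α :=
    { toFun := fun x => (Function.update x.1 q x.2, x.1 q)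
      invFun := fun x => (Function.update x.1 q x.2, x.1 q)
      left_inv := fun x => by simp
      right_inv := fun x => by simp }
  have h1 : (𝔼 x : (ι → α) × α, F x.1) = 𝔼 x : (ι → α) × α, F (Function.update x.1 q x.2) :=
    (Fintype.expect_equiv e (fun x => F (Function.update x.1 q x.2)) (fun x => F x.1)
      (fun x => rfl)).symm
  rw [← Finset.univ_product_univ, Finset.expect_product, Finset.expect_product] at h1
  simpa using h1

/-- The average of a product of functions of distinct coordinates is the product of averages. -/
theorem expect_prod_pi (g : ι → α → ℝ) :
    (𝔼 ω : ι → α, ∏ i, g i (ω i)) = ∏ i, 𝔼 a, g i a := by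
  classical
  simp only [Finset.expect_eq_sum_div_card, Finset.prod_div_distrib, Finset.card_univ,
    Finset.prod_const, Fintype.card_fun]
  rw [Finset.prod_univ_sum, Fintype.piFinset_univ]
  push_cast
  rfl

open Classical in
/-- The indicator of a proposition. -/
noncomputable def ind (p : Prop) : ℝ := if p then 1 else 0

theorem ind_of {p : Prop} (h : p) : ind p = 1 := if_pos h

theorem ind_of_not {p : Prop} (h : ¬ p) : ind p = 0 := if_neg h

theorem ind_nonneg (p : Prop) : 0 ≤ ind p := by
  unfold ind; split_ifs <;> norm_num

theorem ind_le_one (p : Prop) : ind p ≤ 1 := by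
  unfold ind; split_ifs <;> norm_num

theorem ind_mono {p p' : Prop} (h : p → p') : ind p ≤ ind p' := by
  by_cases hp : p
  · rw [ind_of hp, ind_of (h hp)]
  · rw [ind_of_not hp]; exact ind_nonneg _

theorem ind_not (p : Prop) : ind (¬ p) = 1 - ind p := by
  by_cases hp : p
  · rw [ind_of hp, ind_of_not (not_not.2 hp)]; norm_num
  · rw [ind_of_not hp, ind_of hp]; norm_num

/-- Independence of coordinates; those outside `S` contribute the factor 1. -/
theorem expect_ind_forall [Nonempty α] (S : Finset ι) (e : ι → α → Prop) :
    (𝔼 ω : ι → α, ind (∀ i ∈ S, e i (ω i))) = ∏ i ∈ S, 𝔼 a, ind (e i a) := by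
  have h := expect_prod_pi (fun i a => if i ∈ S then ind (e i a) else 1)
  have h2 : ∀ ω : ι → α, (∏ i, if i ∈ S then ind (e i (ω i)) else 1)
      = ind (∀ i ∈ S, e i (ω i)) := by
    intro ω
    classical
    rw [Finset.prod_ite_mem, Finset.univ_inter]
    simp only [ind]
    rw [Finset.prod_ite_zero]
    simp
  simp only [h2] at h
  rw [h, ← Finset.prod_subset (Finset.subset_univ S)]
  · exact Finset.prod_congr rfl (fun i hi => by simp [hi])
  · intro i _ hi
    simp [hi]

theorem expect_ind_not [Nonempty α] (e : α → Prop) :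
    (𝔼 a, ind (¬ e a)) = 1 - 𝔼 a, ind (e a) := by
  simp only [ind_not, Finset.expect_sub_distrib]
  simp

/-- The probability that none of the devices in `S` does something that each does with
probability `p`. -/
theorem expect_card_eq_zero [Nonempty α] (S : Finset ι) (e : α → Prop) [DecidablePred e] (p : ℝ)
    (hp : (𝔼 a, ind (e a)) = p) :
    (𝔼 ω : ι → α, ind (#{i ∈ S | e (ω i)} = 0)) = (1 - p) ^ #S := by
  have h := expect_ind_forall S (fun _ a => ¬ e a)
  simp only [expect_ind_not, hp, Finset.prod_const] at h
  rw [← h]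
  refine Finset.expect_congr rfl fun ω _ => ?_
  simp [Finset.filter_eq_empty_iff]

/-- The probability that exactly one device in `S` does something that each does with
probability `p`. -/
theorem expect_card_eq_one [Nonempty α] (S : Finset ι) (e : α → Prop) [DecidablePred e] (p : ℝ)
    (hp : (𝔼 a, ind (e a)) = p) :
    (𝔼 ω : ι → α, ind (#{i ∈ S | e (ω i)} = 1)) = #S * (p * (1 - p) ^ (#S - 1)) := by
  -- The event splits according to the unique device `u`; the form `i = u ↔ e (ω i)` makes each
  -- piece a product event.
  have h1 : ∀ u ∈ S, (𝔼 ω : ι → α, ind (∀ i ∈ S, (i = u ↔ e (ω i)))) = p * (1 - p) ^ (#S - 1) := by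
    intro u hu
    rw [expect_ind_forall S (fun i a => (i = u ↔ e a)), ← Finset.mul_prod_erase S _ hu]
    congr 1
    · simpa using hp
    · rw [← Finset.card_erase_of_mem hu, ← Finset.prod_const]
      refine Finset.prod_congr rfl fun i hi => ?_
      have : i ≠ u := (Finset.mem_erase.1 hi).1
      simp only [this, false_iff, expect_ind_not, hp]
  rw [← nsmul_eq_mul, ← Finset.sum_const, ← Finset.sum_congr rfl h1, ← Finset.expect_sum_comm]
  refine Finset.expect_congr rfl fun ω _ => ?_
  have key : ∀ u ∈ S, (∀ i ∈ S, (i = u ↔ e (ω i))) ↔ {i ∈ S | e (ω i)} = {u} := by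
    intro u hu
    rw [Finset.ext_iff]
    simp only [Finset.mem_filter, Finset.mem_singleton]
    constructor
    · intro h i
      constructor
      · rintro ⟨a, b⟩; exact (h i a).2 b
      · rintro rfl; exact ⟨hu, (h i hu).1 rfl⟩
    · intro h i hi
      rw [← h i]; simp [hi]
  by_cases hc : #{i ∈ S | e (ω i)} = 1
  · obtain ⟨u, hu⟩ := Finset.card_eq_one.1 hc
    have huS : u ∈ S := (Finset.mem_filter.1 (hu ▸ Finset.mem_singleton_self u)).1
    rw [Finset.sum_eq_single_of_mem u huS]
    · rw [ind_of hc, ind_of ((key u huS).2 hu)]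
    · intro w hw hne
      refine ind_of_not ?_
      rw [key w hw, hu]
      simpa using hne.symm
  · rw [ind_of_not hc]
    symm
    refine Finset.sum_eq_zero fun u hu => ind_of_not ?_
    rw [key u hu]
    intro h; apply hc; rw [h]; simp

end Averages

/-! ### Algorithms organized in rounds -/

/-- A randomized algorithm that works in rounds of `len` slots. In each round a device gets fresh
random bits and fixes all its actions of the round in advance. -/
structure RoundAlg where
  /-- number of slots of a round -/
  len : ℕ
  /-- number of rounds -/
  rounds : ℕ
  /-- local states of a device -/
  St : Type
  /-- the initial state -/
  init : Option Msg → St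
  /-- the action in a slot, from the round, the state, the random bits and the slot -/
  act : ℕ → St → (Fin (len + 1) → Bool) → ℕ → Action
  /-- the state after a round, from the round, the state, the random bits and the feedback -/
  next : ℕ → St → (Fin (len + 1) → Bool) → (ℕ → Option Signal) → St
  /-- the output at the end -/
  out : St → Option Msg

namespace RoundAlg

/-- The random bits that a device uses in one round. -/
abbrev Bits (A : RoundAlg) : Type := Fin (A.len + 1) → Bool

/-- The random bits of each round, read from one long string. -/
def tape (A : RoundAlg) (r : Fin (A.rounds * (A.len + 1)) → Bool) (q : ℕ) : A.Bits :=
  fun k => if h : q < A.rounds then r (finProdFinEquiv (⟨q, h⟩, k)) else false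

/-- A round algorithm as a protocol: the feedback of a round is stored until its end. -/
def toProtocol (A : RoundAlg) : Protocol where
  coins := A.rounds * (A.len + 1)
  slots := A.rounds * A.len
  State := (ℕ → A.Bits) × A.St × (ℕ → Option Signal)
  start i r := (A.tape r, A.init i, fun _ => none)
  act t x := A.act (t / A.len) x.2.1 (x.1 (t / A.len)) (t % A.len)
  next t x sig :=
    if t % A.len + 1 = A.len then
      (x.1, A.next (t / A.len) x.2.1 (x.1 (t / A.len))
        (Function.update x.2.2 (t % A.len) sig), fun _ => none)
    else (x.1, x.2.1, Function.update x.2.2 (t % A.len) sig)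
  output x := A.out x.2.1

/-- Extend the random bits of the rounds by default values. -/
def extend (A : RoundAlg) {V : Type*} (ω : Fin A.rounds → V → A.Bits) (q : ℕ) (v : V) : A.Bits :=
  fun k => if h : q < A.rounds then ω ⟨q, h⟩ v k else false

theorem extend_update_of_ne (A : RoundAlg) {V : Type*} (ω : Fin A.rounds → V → A.Bits) (q : Fin A.rounds) (β : V → A.Bits)
    (i : ℕ) (hi : i ≠ q) : A.extend (Function.update ω q β) i = A.extend ω i := by
  funext v k
  simp only [extend]
  split_ifs with h
  · rw [Function.update_of_ne]
    rintro rfl; exact hi rfl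
  · rfl

theorem extend_update_self (A : RoundAlg) {V : Type*} (ω : Fin A.rounds → V → A.Bits) (q : Fin A.rounds) (β : V → A.Bits) :
    A.extend (Function.update ω q β) q = β := by
  funext v k
  simp [extend]

variable {V : Type*} [Fintype V] [DecidableEq V]

/-- The feedback to `v` in the slots of a round. -/
noncomputable def roundFeedback (A : RoundAlg) (M : Model) (G : SimpleGraph V)
    [DecidableRel G.Adj] (q : ℕ) (c : V → A.St) (β : V → A.Bits) (v : V) : ℕ → Option Signal :=
  fun j => if j < A.len then feedback M G (fun w => A.act q (c w) (β w) j) v else none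

/-- The states after a round. -/
noncomputable def step (A : RoundAlg) (M : Model) (G : SimpleGraph V)
    [DecidableRel G.Adj] (q : ℕ) (c : V → A.St) (β : V → A.Bits) : V → A.St :=
  fun v => A.next q (c v) (β v) (A.roundFeedback M G q c β v)

/-- The states after `q` rounds. -/
noncomputable def exec (A : RoundAlg) (M : Model) (G : SimpleGraph V)
    [DecidableRel G.Adj] (s : V) (m : Msg) (τ : ℕ → V → A.Bits) : ℕ → V → A.St
  | 0 => fun v => A.init (if v = s then some m else none)
  | q + 1 => A.step M G q (A.exec M G s m τ q) (τ q)

variable (A : RoundAlg) (M : Model) (G : SimpleGraph V) [DecidableRel G.Adj] (s : V) (m : Msg)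

/-- The buffer holds the feedback of the earlier slots of the current round and is emptied when the
round closes. Since actions are fixed for a whole round, this feedback is a function of the states
at the start of the round. -/
theorem run_toProtocol (hlen : 0 < A.len) (r : V → Fin A.toProtocol.coins → Bool) (t : ℕ) (v : V) :
    A.toProtocol.run M G s m r t v =
      (A.tape (r v), A.exec M G s m (fun q w => A.tape (r w) q) (t / A.len) v,
        fun i => if i < t % A.len then
          A.roundFeedback M G (t / A.len) (A.exec M G s m (fun q w => A.tape (r w) q) (t / A.len))
            (fun w => A.tape (r w) (t / A.len)) v i else none) := by
  induction t generalizing v with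
  | zero => simp [Protocol.run, toProtocol, exec]
  | succ t ih =>
    have hmod : t % A.len < A.len := Nat.mod_lt _ hlen
    have hdm := Nat.div_add_mod t A.len
    simp only [Protocol.run, ih]
    simp only [toProtocol]
    set q := t / A.len with hq
    set j := t % A.len with hj
    set c := A.exec M G s m (fun q w => A.tape (r w) q) q with hc
    have hupd : (Function.update (fun i => if i < j then
          A.roundFeedback M G q c (fun w => A.tape (r w) q) v i else none) j
          (feedback M G (fun w => A.act q (c w) (A.tape (r w) q) j) v))
        = fun i => if i < j + 1 then
          A.roundFeedback M G q c (fun w => A.tape (r w) q) v i else none := by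
      funext i
      by_cases hi : i = j
      · subst hi
        simp [roundFeedback, hmod]
      · rw [Function.update_of_ne hi]
        have : i < j + 1 ↔ i < j := by omega
        simp [this]
    by_cases hend : j + 1 = A.len
    · have h1 : t + 1 = A.len * (q + 1) := by rw [mul_add, mul_one]; omega
      have h2 : (t + 1) / A.len = q + 1 := by rw [h1, Nat.mul_div_cancel_left _ hlen]
      have h3 : (t + 1) % A.len = 0 := by rw [h1, Nat.mul_mod_right]
      rw [if_pos hend, h2, h3, hupd]
      simp only [exec, step, hend, Nat.not_lt_zero, if_false, ← hc]
      congr 3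
      funext i
      by_cases hi : i < A.len
      · simp [hi]
      · simp [hi, roundFeedback]
    · have h1 : t + 1 = (j + 1) + A.len * q := by omega
      have h2 : (t + 1) / A.len = q := by
        rw [h1, Nat.add_mul_div_left _ _ hlen, Nat.div_eq_of_lt (by omega), zero_add]
      have h3 : (t + 1) % A.len = j + 1 := by
        rw [h1, Nat.add_mul_mod_self_left, Nat.mod_eq_of_lt (by omega)]
      rw [if_neg hend, h2, h3, hupd]

theorem output_toProtocol (hlen : 0 < A.len) (r : V → Fin A.toProtocol.coins → Bool) (v : V) :
    A.toProtocol.output (A.toProtocol.run M G s m r A.toProtocol.slots v) =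
      A.out (A.exec M G s m (fun q w => A.tape (r w) q) A.rounds v) := by
  rw [run_toProtocol A M G s m hlen]
  simp [toProtocol, Nat.mul_div_cancel _ hlen]

theorem sum_range_mul_eq (f : ℕ → ℕ) (a b : ℕ) :
    ∑ t ∈ range (a * b), f t = ∑ q ∈ range a, ∑ j ∈ range b, f (q * b + j) := by
  induction a with
  | zero => simp
  | succ a ih => rw [Nat.succ_mul, Finset.sum_range_add, ih, Finset.sum_range_succ]

open Classical in
theorem energy_toProtocol (hlen : 0 < A.len) (r : V → Fin A.toProtocol.coins → Bool) (v : V) :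
    A.toProtocol.energy M G s m r v = ∑ q ∈ range A.rounds,
      #{j ∈ range A.len | A.act q (A.exec M G s m (fun q w => A.tape (r w) q) q v)
        (A.tape (r v) q) j ≠ Action.idle} := by
  have h1 : {t : ℕ | t < A.toProtocol.slots ∧
      A.toProtocol.act t (A.toProtocol.run M G s m r t v) ≠ Action.idle} =
      (({t ∈ range (A.rounds * A.len) |
        A.toProtocol.act t (A.toProtocol.run M G s m r t v) ≠ Action.idle} : Finset ℕ) : Set ℕ) := by
    ext t
    rw [Finset.coe_filter]
    simp only [Set.mem_ofPred_eq, Finset.mem_range]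
    rfl
  unfold Protocol.energy
  rw [h1, Set.ncard_coe_finset, Finset.card_filter, sum_range_mul_eq]
  refine Finset.sum_congr rfl fun q hq => ?_
  rw [Finset.card_filter]
  refine Finset.sum_congr rfl fun j hj => ?_
  have hj' := Finset.mem_range.1 hj
  have h2 : (q * A.len + j) / A.len = q := by
    rw [add_comm, Nat.add_mul_div_right _ _ hlen, Nat.div_eq_of_lt hj', zero_add]
  have h3 : (q * A.len + j) % A.len = j := by
    rw [add_comm, Nat.add_mul_mod_self_right, Nat.mod_eq_of_lt hj']
  rw [run_toProtocol A M G s m hlen, h2, h3]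
  simp only [toProtocol, h2, h3]

/-- Regrouping the coins by round instead of by device is a bijection. It turns the rounds into
independent coordinates, which is what `expect_resample` needs. -/
theorem successProb_toProtocol (hlen : 0 < A.len) :
    A.toProtocol.successProb M G s m = 𝔼 ω : Fin A.rounds → V → A.Bits,
      ind (∀ v, A.out (A.exec M G s m (A.extend ω) A.rounds v) = some m) := by
  classical
  let e : (V → Fin A.toProtocol.coins → Bool) ≃ (Fin A.rounds → V → A.Bits) :=
    { toFun := fun r q v k => r v (finProdFinEquiv (q, k))
      invFun := fun ω v i => ω (finProdFinEquiv.symm i).1 v (finProdFinEquiv.symm i).2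
      left_inv := fun r => by
        funext v i
        exact congrArg (r v) (finProdFinEquiv.apply_symm_apply i)
      right_inv := fun ω => by funext q v k; simp }
  have he : ∀ r : V → Fin A.toProtocol.coins → Bool,
      (fun q w => A.tape (r w) q) = A.extend (e r) := by
    intro r; funext q w k
    simp [tape, extend, e]
  have h1 : A.toProtocol.successProb M G s m = 𝔼 r : V → Fin A.toProtocol.coins → Bool,
      ind (A.toProtocol.Succeeds M G s m r) := by
    unfold Protocol.successProb
    rw [Finset.expect_eq_sum_div_card, Nat.card_eq_fintype_card, Nat.card_eq_fintype_card]
    congr 1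
    rw [Fintype.card_subtype]
    simp [ind]
  rw [h1]
  refine Fintype.expect_equiv e _ _ fun r => ?_
  simp only [Protocol.Succeeds, output_toProtocol A M G s m hlen, he]

theorem exec_congr {τ τ' : ℕ → V → A.Bits} (q : ℕ) (h : ∀ i < q, τ i = τ' i) :
    A.exec M G s m τ q = A.exec M G s m τ' q := by
  induction q with
  | zero => rfl
  | succ q ih =>
    simp only [exec]
    rw [ih fun i hi => h i (by omega), h q (by omega)]

/-- Causality: the bits of round `q` are fresh with respect to everything up to the start of that
round. -/
theorem exec_update (ω : Fin A.rounds → V → A.Bits) (q : Fin A.rounds) (β : V → A.Bits)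
    (i : ℕ) (hi : i ≤ q) :
    A.exec M G s m (A.extend (Function.update ω q β)) i = A.exec M G s m (A.extend ω) i :=
  A.exec_congr M G s m i fun k hk => A.extend_update_of_ne ω q β k (by omega)

/-- A function whose average does not grow in a step, whatever the state, does not grow on
average. -/
theorem expect_exec_succ_le {q : ℕ} (hq : q < A.rounds) (F F' : (V → A.St) → ℝ)
    (h : ∀ ω : Fin A.rounds → V → A.Bits,
      (𝔼 β : V → A.Bits, F' (A.step M G q (A.exec M G s m (A.extend ω) q) β)) ≤
        F (A.exec M G s m (A.extend ω) q)) :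
    (𝔼 ω, F' (A.exec M G s m (A.extend ω) (q + 1))) ≤
      𝔼 ω, F (A.exec M G s m (A.extend ω) q) := by
  rw [expect_resample ⟨q, hq⟩]
  refine Finset.expect_le_expect fun ω _ => ?_
  refine le_trans (le_of_eq ?_) (h ω)
  refine Finset.expect_congr rfl fun β _ => ?_
  have h1 := A.exec_update M G s m ω ⟨q, hq⟩ β q le_rfl
  have h2 := A.extend_update_self ω ⟨q, hq⟩ β
  simp only at h2
  simp only [exec, h1, h2]

end RoundAlg

/-! ### Relaying messages to neighbors, and algorithms organized in blocks -/

/-- What a device does in a block: try to inform its neighbors of a message, try to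
learn a message from a neighbor, or nothing. -/
inductive Role where
  | send (msg : Msg)
  | recv
  | idle

/-- Whether a role is to send. -/
def Role.IsSend (r : Role) : Prop := ∃ x, r = .send x

/-- A message that can be read off a signal. -/
noncomputable def Signal.heard : Signal → Option Msg
  | .all msgs => msgs.toList.head?
  | .message x => some x
  | .silence => none
  | .noise => none

/-- A message that can be read off the feedback of a round of `len` slots. -/
noncomputable def received (len : ℕ) (fb : ℕ → Option Signal) : Option Msg :=
  (List.range len).findSome? fun j => (fb j).bind Signal.heard

/-- A way to relay messages from senders to adjacent receivers in `rounds` rounds of `len` slots.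
A receiver keeps a level, which says where it listens. -/
structure Relay where
  /-- number of slots of a round -/
  len : ℕ
  /-- number of rounds -/
  rounds : ℕ
  /-- the slot in which a sender sends, from the random bits of the round -/
  slot : (Fin (len + 1) → Bool) → ℕ
  /-- whether a receiver of a given level listens in a given slot -/
  listens : ℕ → ℕ → Bool
  /-- the level in the next round, from the current one and the feedback -/
  level : ℕ → (ℕ → Option Signal) → ℕ

section Relay

variable {V : Type*} [Fintype V] [DecidableEq V]

/-- The action of a device in a slot, from its role, its level and its random bits. -/
def Relay.act (ρ : Relay) (r : Role) (l : ℕ) (β : Fin (ρ.len + 1) → Bool) (j : ℕ) : Action :=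
  match r with
  | .send x => if ρ.slot β = j then .send x else .idle
  | .recv => if ρ.listens l j then .listen else .idle
  | .idle => .idle

/-- The feedback to `v` in a round. -/
noncomputable def Relay.hears (ρ : Relay) (M : Model) (G : SimpleGraph V) [DecidableRel G.Adj]
    (role : V → Role) (lev : V → ℕ) (β : V → Fin (ρ.len + 1) → Bool) (v : V) :
    ℕ → Option Signal :=
  fun j => if j < ρ.len then feedback M G (fun w => ρ.act (role w) (lev w) (β w) j) v else none

open Classical in
/-- The neighbors of `v` that try to send. -/
noncomputable def senders (G : SimpleGraph V) [DecidableRel G.Adj] (role : V → Role) (v : V) :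
    Finset V :=
  {w ∈ G.neighborFinset v | (role w).IsSend}

theorem mem_senders (G : SimpleGraph V) [DecidableRel G.Adj] (role : V → Role) (v w : V) :
    w ∈ senders G role v ↔ G.Adj v w ∧ (role w).IsSend := by
  simp [senders]

/-- The relay works in the model `M` on networks of maximum degree at most `Δ`: the potential `pot`
of a receiver, which depends on the number of its sending neighbors and its level, goes down by the
factor `κ` in a round, where the potential counts as `0` once a message is received. -/
structure Relay.Works (ρ : Relay) (M : Model) (Δ : ℕ) (κ F : ℝ) (pot : ℕ → ℕ → ℝ) : Prop where
  len_pos : 0 < ρ.len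
  nonneg : 0 ≤ κ
  bound_nonneg : 0 ≤ F
  one_le : ∀ k l, 1 ≤ pot k l
  start : ∀ k, 0 < k → k ≤ Δ → pot k 0 ≤ F
  round : ∀ {V : Type} [Fintype V] [DecidableEq V] (G : SimpleGraph V) [DecidableRel G.Adj]
    (role : V → Role) (lev : V → ℕ) (v : V), role v = .recv → 0 < #(senders G role v) →
    #(senders G role v) ≤ Δ →
    (𝔼 β : V → Fin (ρ.len + 1) → Bool, ind (received ρ.len (ρ.hears M G role lev β v) = none) *
      pot #(senders G role v) (ρ.level (lev v) (ρ.hears M G role lev β v))) ≤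
    κ * pot #(senders G role v) (lev v)

theorem mem_of_heard_hear {M : Model} {inc : Multiset Msg} {x : Msg}
    (h : (hear M inc).heard = some x) : x ∈ inc := by
  cases M with
  | LOCAL =>
    simp only [hear, Signal.heard] at h
    exact Multiset.mem_toList.1 (List.mem_of_mem_head? h)
  | CD =>
    simp only [hear] at h
    split_ifs at h with h1 h2
    · have := h1.choose_spec
      simp only [Signal.heard, Option.some.injEq] at h
      rw [this, ← h]; simp
    · simp [Signal.heard] at h
    · simp [Signal.heard] at h
  | NoCD =>
    simp only [hear] at h
    split_ifs at h with h1
    · have := h1.choose_spec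
      simp only [Signal.heard, Option.some.injEq] at h
      rw [this, ← h]; simp
    · simp [Signal.heard] at h

theorem mem_incoming {G : SimpleGraph V} [DecidableRel G.Adj] {a : V → Action} {v : V} {x : Msg} :
    x ∈ incoming G a v ↔ ∃ w, G.Adj v w ∧ a w = .send x := by
  unfold incoming
  simp only [Multiset.mem_filterMap, Finset.mem_val, SimpleGraph.mem_neighborFinset]
  refine exists_congr fun w => and_congr_right fun _ => ?_
  cases a w <;> simp [Action.sent]

/-- Whatever a device receives was sent to it. -/
theorem Relay.sound (ρ : Relay) {M : Model} {G : SimpleGraph V} [DecidableRel G.Adj]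
    {role : V → Role} {lev : V → ℕ} {β : V → Fin (ρ.len + 1) → Bool} {v : V} {x : Msg}
    (h : received ρ.len (ρ.hears M G role lev β v) = some x) :
    role v = .recv ∧ ∃ w, G.Adj v w ∧ role w = .send x := by
  obtain ⟨j, hj, hx⟩ := List.exists_of_findSome?_eq_some h
  rw [List.mem_range] at hj
  simp only [Relay.hears, hj, if_true, feedback] at hx
  cases hv : role v with
  | send y =>
    simp only [hv, Relay.act] at hx
    split_ifs at hx <;> simp at hx
  | idle => simp [hv, Relay.act] at hx
  | recv =>
    refine ⟨rfl, ?_⟩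
    have hact : ρ.act (role v) (lev v) (β v) j = .listen ∨
        ρ.act (role v) (lev v) (β v) j = .idle := by
      rw [hv]; simp only [Relay.act]; split_ifs <;> simp
    rcases hact with hact | hact
    · rw [hact] at hx
      simp only [Option.bind_some] at hx
      obtain ⟨w, hw, hs⟩ := mem_incoming.1 (mem_of_heard_hear hx)
      refine ⟨w, hw, ?_⟩
      cases hr : role w with
      | send y =>
        simp only [hr, Relay.act] at hs
        split_ifs at hs
        rw [Action.send.injEq] at hs
        rw [hs]
      | recv =>
        simp only [hr, Relay.act] at hs
        split_ifs at hs
      | idle => simp [hr, Relay.act] at hs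
    · rw [hact] at hx
      simp at hx

end Relay

/-- An algorithm that works in blocks, in which receivers learn messages of sending neighbors. -/
structure BlockAlg where
  /-- number of blocks -/
  blocks : ℕ
  /-- local states of a device -/
  St : Type
  /-- the initial state -/
  init : Option Msg → St
  /-- the role in a block -/
  role : ℕ → St → Role
  /-- the state after a block, from the message received, if any, and a random bit -/
  next : ℕ → St → Option Msg → Bool → St
  /-- the output at the end -/
  out : St → Option Msg

namespace BlockAlg

/-- Each block is carried out by the rounds of a relay and a silent round in which the state is
updated. -/
noncomputable def toRoundAlg (B : BlockAlg) (ρ : Relay) : RoundAlg where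
  len := ρ.len
  rounds := B.blocks * (ρ.rounds + 1)
  St := B.St × ℕ × Option Msg
  init i := (B.init i, 0, none)
  act q x β j :=
    if q % (ρ.rounds + 1) < ρ.rounds then ρ.act (B.role (q / (ρ.rounds + 1)) x.1) x.2.1 β j
    else .idle
  next q x β fb :=
    if q % (ρ.rounds + 1) < ρ.rounds then
      (x.1, ρ.level x.2.1 fb, x.2.2.or (received ρ.len fb))
    else (B.next (q / (ρ.rounds + 1)) x.1 x.2.2 (β 0), 0, none)
  out x := B.out x.1

variable (B : BlockAlg) (ρ : Relay)

/-! ### The execution of a block and its energy. -/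

section Run

variable {V : Type*} [Fintype V] [DecidableEq V] (M : Model) (G : SimpleGraph V)
  [DecidableRel G.Adj] (s : V) (m : Msg)

theorem step_relay {b i : ℕ} (hi : i < ρ.rounds) (c : V → B.St × ℕ × Option Msg)
    (β : V → Fin (ρ.len + 1) → Bool) (v : V) :
    (B.toRoundAlg ρ).step M G (b * (ρ.rounds + 1) + i) c β v =
      ((c v).1, ρ.level (c v).2.1 (ρ.hears M G (fun w => B.role b (c w).1) (fun w => (c w).2.1) β v),
        (c v).2.2.or (received ρ.len
          (ρ.hears M G (fun w => B.role b (c w).1) (fun w => (c w).2.1) β v))) := by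
  have h1 : (b * (ρ.rounds + 1) + i) % (ρ.rounds + 1) = i := by
    rw [add_comm, Nat.add_mul_mod_self_right, Nat.mod_eq_of_lt (by omega)]
  have h2 : (b * (ρ.rounds + 1) + i) / (ρ.rounds + 1) = b := by
    rw [add_comm, Nat.add_mul_div_right _ _ (by omega), Nat.div_eq_of_lt (by omega), zero_add]
  simp only [RoundAlg.step, toRoundAlg, h1, h2, hi, if_true]
  have : ∀ fb fb' : ℕ → Option Signal, fb = fb' →
      ((c v).1, ρ.level (c v).2.1 fb, (c v).2.2.or (received ρ.len fb)) =
      ((c v).1, ρ.level (c v).2.1 fb', (c v).2.2.or (received ρ.len fb')) := by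
    rintro _ _ rfl; rfl
  apply this
  funext j
  simp only [RoundAlg.roundFeedback, Relay.hears, h1, h2, hi, if_true]

theorem step_update (b : ℕ) (c : V → B.St × ℕ × Option Msg)
    (β : V → Fin (ρ.len + 1) → Bool) (v : V) :
    (B.toRoundAlg ρ).step M G (b * (ρ.rounds + 1) + ρ.rounds) c β v =
      (B.next b (c v).1 (c v).2.2 (β v 0), 0, none) := by
  have h1 : (b * (ρ.rounds + 1) + ρ.rounds) % (ρ.rounds + 1) = ρ.rounds := by
    rw [add_comm, Nat.add_mul_mod_self_right, Nat.mod_eq_of_lt (by omega)]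
  have h2 : (b * (ρ.rounds + 1) + ρ.rounds) / (ρ.rounds + 1) = b := by
    rw [add_comm, Nat.add_mul_div_right _ _ (by omega), Nat.div_eq_of_lt (by omega), zero_add]
  simp only [RoundAlg.step, toRoundAlg, h1, h2, lt_irrefl, if_false]

/-- The states of the round algorithm. -/
noncomputable abbrev conf (τ : ℕ → V → Fin (ρ.len + 1) → Bool) (q : ℕ) :
    V → B.St × ℕ × Option Msg :=
  (B.toRoundAlg ρ).exec M G s m τ q

/-- The states at the beginning of a block. -/
noncomputable def state (τ : ℕ → V → Fin (ρ.len + 1) → Bool) (b : ℕ) (v : V) : B.St :=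
  (B.conf ρ M G s m τ (b * (ρ.rounds + 1)) v).1

variable (τ : ℕ → V → Fin (ρ.len + 1) → Bool)

theorem conf_succ_relay {b i : ℕ} (hi : i < ρ.rounds) (v : V) :
    let c := B.conf ρ M G s m τ (b * (ρ.rounds + 1) + i)
    let fb := ρ.hears M G (fun w => B.role b (c w).1) (fun w => (c w).2.1)
      (τ (b * (ρ.rounds + 1) + i)) v
    B.conf ρ M G s m τ (b * (ρ.rounds + 1) + (i + 1)) v =
      ((c v).1, ρ.level (c v).2.1 fb, (c v).2.2.or (received ρ.len fb)) :=
  B.step_relay ρ M G hi (B.conf ρ M G s m τ (b * (ρ.rounds + 1) + i)) _ v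

theorem conf_succ_update (b : ℕ) (v : V) :
    B.conf ρ M G s m τ ((b + 1) * (ρ.rounds + 1)) v =
      (B.next b (B.conf ρ M G s m τ (b * (ρ.rounds + 1) + ρ.rounds) v).1
        (B.conf ρ M G s m τ (b * (ρ.rounds + 1) + ρ.rounds) v).2.2
        (τ (b * (ρ.rounds + 1) + ρ.rounds) v 0), 0, none) := by
  have h : (b + 1) * (ρ.rounds + 1) = b * (ρ.rounds + 1) + ρ.rounds + 1 := by ring
  rw [h]
  exact B.step_update ρ M G b (B.conf ρ M G s m τ (b * (ρ.rounds + 1) + ρ.rounds)) _ v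

theorem conf_start (b : ℕ) (v : V) :
    (B.conf ρ M G s m τ (b * (ρ.rounds + 1)) v).2 = (0, none) := by
  cases b with
  | zero => simp [conf, RoundAlg.exec, toRoundAlg]
  | succ b => rw [conf_succ_update]

theorem conf_fst (b : ℕ) {i : ℕ} (hi : i ≤ ρ.rounds) (v : V) :
    (B.conf ρ M G s m τ (b * (ρ.rounds + 1) + i) v).1 = B.state ρ M G s m τ b v := by
  induction i with
  | zero => rfl
  | succ i ih =>
    rw [conf_succ_relay B ρ M G s m τ (by omega)]
    exact ih (by omega)

theorem conf_sound (b : ℕ) {i : ℕ} (hi : i ≤ ρ.rounds) (v : V) (x : Msg)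
    (hx : (B.conf ρ M G s m τ (b * (ρ.rounds + 1) + i) v).2.2 = some x) :
    B.role b (B.state ρ M G s m τ b v) = .recv ∧
      ∃ w, G.Adj v w ∧ B.role b (B.state ρ M G s m τ b w) = .send x := by
  induction i with
  | zero =>
    have h := conf_start B ρ M G s m τ b v
    rw [add_zero, h] at hx
    simp at hx
  | succ i ih =>
    rw [conf_succ_relay B ρ M G s m τ (by omega)] at hx
    simp only [Option.or_eq_some_iff] at hx
    rcases hx with hx | ⟨_, hx⟩
    · exact ih (by omega) hx
    · have h := ρ.sound hx
      simpa only [conf_fst B ρ M G s m τ b (show i ≤ ρ.rounds by omega)] using h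

/-- The message received in a block. -/
noncomputable def got (b : ℕ) (v : V) : Option Msg :=
  (B.conf ρ M G s m τ (b * (ρ.rounds + 1) + ρ.rounds) v).2.2

/-- The random bit used for the update after a block. -/
def coin (b : ℕ) (v : V) : Bool := τ (b * (ρ.rounds + 1) + ρ.rounds) v 0

theorem state_succ (b : ℕ) (v : V) :
    B.state ρ M G s m τ (b + 1) v =
      B.next b (B.state ρ M G s m τ b v) (B.got ρ M G s m τ b v) (coin ρ τ b v) := by
  unfold state
  rw [conf_succ_update]
  simp only [conf_fst B ρ M G s m τ b le_rfl, got, coin]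
  rfl

theorem got_sound {b : ℕ} {v : V} {x : Msg} (hx : B.got ρ M G s m τ b v = some x) :
    B.role b (B.state ρ M G s m τ b v) = .recv ∧
      ∃ w, G.Adj v w ∧ B.role b (B.state ρ M G s m τ b w) = .send x :=
  B.conf_sound ρ M G s m τ b le_rfl v x hx

/-- A receiver with a sending neighbor has not received a message so far. -/
def Uninformed (b : ℕ) (c : V → B.St × ℕ × Option Msg) (v : V) : Prop :=
  B.role b (c v).1 = .recv ∧ 0 < #(senders G (fun w => B.role b (c w).1) v) ∧ (c v).2.2 = none

/-- In block `b` the receiver `v` has a sending neighbor but does not receive a message. -/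
def Fails (b : ℕ) (v : V) : Prop :=
  B.Uninformed G b (B.conf ρ M G s m τ (b * (ρ.rounds + 1) + ρ.rounds)) v

/-- The only way in which the absence of failures enters the analysis of the algorithm. -/
theorem got_ne_none {b : ℕ} {v w : V} (h : ¬ B.Fails ρ M G s m τ b v) (hvw : G.Adj v w)
    (hv : B.role b (B.state ρ M G s m τ b v) = .recv)
    (hw : (B.role b (B.state ρ M G s m τ b w)).IsSend) :
    B.got ρ M G s m τ b v ≠ none := by
  intro hg
  apply h
  refine ⟨?_, ?_, hg⟩
  · rw [conf_fst B ρ M G s m τ b le_rfl, hv]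
  · refine Finset.card_pos.2 ⟨w, (mem_senders _ _ _ _).2 ⟨hvw, ?_⟩⟩
    rw [conf_fst B ρ M G s m τ b le_rfl]
    exact hw

-- Roles are fixed at the start of a block and the updating round is silent, so energy is spent only
-- in the relay rounds of blocks with a role other than `idle`.
open Classical in
theorem energy_le (hlen : 0 < ρ.len) (e : ℕ)
    (he : ∀ r l β, #{j ∈ range ρ.len | ρ.act r l β j ≠ Action.idle} ≤ e)
    (N : ℕ) (v : V)
    (hN : ∀ τ : ℕ → V → Fin (ρ.len + 1) → Bool,
      #{b ∈ range B.blocks | B.role b (B.state ρ M G s m τ b v) ≠ Role.idle} ≤ N)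
    (r : V → Fin (B.toRoundAlg ρ).toProtocol.coins → Bool) :
    (B.toRoundAlg ρ).toProtocol.energy M G s m r v ≤ N * (ρ.rounds * e) := by
  rw [RoundAlg.energy_toProtocol _ M G s m hlen]
  set τ : ℕ → V → Fin (ρ.len + 1) → Bool := fun q w => (B.toRoundAlg ρ).tape (r w) q
  change ∑ q ∈ range (B.blocks * (ρ.rounds + 1)), #{j ∈ range ρ.len | (B.toRoundAlg ρ).act q
    (B.conf ρ M G s m τ q v) (τ q v) j ≠ Action.idle} ≤ _
  rw [RoundAlg.sum_range_mul_eq]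
  have h1 : ∀ b, ∑ i ∈ range (ρ.rounds + 1), #{j ∈ range ρ.len |
      (B.toRoundAlg ρ).act (b * (ρ.rounds + 1) + i)
        (B.conf ρ M G s m τ (b * (ρ.rounds + 1) + i) v)
        (τ (b * (ρ.rounds + 1) + i) v) j ≠ Action.idle} ≤
      if B.role b (B.state ρ M G s m τ b v) ≠ Role.idle then ρ.rounds * e else 0 := by
    intro b
    have hi : ∀ i ≤ ρ.rounds, ∀ j, (B.toRoundAlg ρ).act (b * (ρ.rounds + 1) + i)
        (B.conf ρ M G s m τ (b * (ρ.rounds + 1) + i) v) (τ (b * (ρ.rounds + 1) + i) v) j =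
        if i < ρ.rounds then ρ.act (B.role b (B.state ρ M G s m τ b v))
          (B.conf ρ M G s m τ (b * (ρ.rounds + 1) + i) v).2.1
          (τ (b * (ρ.rounds + 1) + i) v) j else Action.idle := by
      intro i hi j
      have h1 : (b * (ρ.rounds + 1) + i) % (ρ.rounds + 1) = i := by
        rw [add_comm, Nat.add_mul_mod_self_right, Nat.mod_eq_of_lt (by omega)]
      have h2 : (b * (ρ.rounds + 1) + i) / (ρ.rounds + 1) = b := by
        rw [add_comm, Nat.add_mul_div_right _ _ (by omega), Nat.div_eq_of_lt (by omega), zero_add]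
      change (if (b * (ρ.rounds + 1) + i) % (ρ.rounds + 1) < ρ.rounds then
        ρ.act (B.role ((b * (ρ.rounds + 1) + i) / (ρ.rounds + 1))
          (B.conf ρ M G s m τ (b * (ρ.rounds + 1) + i) v).1)
          (B.conf ρ M G s m τ (b * (ρ.rounds + 1) + i) v).2.1
          (τ (b * (ρ.rounds + 1) + i) v) j else Action.idle) = _
      rw [h1, h2, conf_fst B ρ M G s m τ b hi v]
    rw [Finset.sum_range_succ]
    have hlast : #{j ∈ range ρ.len | (B.toRoundAlg ρ).act (b * (ρ.rounds + 1) + ρ.rounds)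
        (B.conf ρ M G s m τ (b * (ρ.rounds + 1) + ρ.rounds) v)
        (τ (b * (ρ.rounds + 1) + ρ.rounds) v) j ≠ Action.idle} = 0 := by
      rw [Finset.card_eq_zero, Finset.filter_eq_empty_iff]
      intro j _
      rw [hi _ le_rfl]
      simp
    rw [hlast, add_zero]
    split_ifs with hr
    · calc _ ≤ ∑ i ∈ range ρ.rounds, e := by
            refine Finset.sum_le_sum fun i hir => ?_
            have hir := Finset.mem_range.1 hir
            simp only [hi i hir.le, hir, if_true]
            exact he _ _ _
        _ = ρ.rounds * e := by simp
    · rw [not_not] at hr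
      refine le_of_eq (Finset.sum_eq_zero fun i hir => ?_)
      have hir := Finset.mem_range.1 hir
      rw [Finset.card_eq_zero, Finset.filter_eq_empty_iff]
      intro j _
      rw [hi i hir.le, hr]
      simp [Relay.act]
  calc _ ≤ ∑ b ∈ range B.blocks,
        if B.role b (B.state ρ M G s m τ b v) ≠ Role.idle then ρ.rounds * e else 0 :=
        Finset.sum_le_sum fun b _ => h1 b
    _ = #{b ∈ range B.blocks | B.role b (B.state ρ M G s m τ b v) ≠ Role.idle} *
          (ρ.rounds * e) := by
        rw [← Finset.sum_filter, Finset.sum_const, smul_eq_mul]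
    _ ≤ _ := Nat.mul_le_mul_right _ (hN τ)

end Run

/-! ### The probability that a receiver misses a message. -/

section Failure

variable {V : Type} [Fintype V] [DecidableEq V] (M : Model) (G : SimpleGraph V)
  [DecidableRel G.Adj] (s : V) (m : Msg)

/-- The random bits of all devices in all rounds. -/
abbrev Sample (V : Type) : Type := Fin (B.toRoundAlg ρ).rounds → V → (B.toRoundAlg ρ).Bits

/-- The potential of a device in a block: that of an uninformed receiver, and `0` otherwise. -/
noncomputable def potential (pot : ℕ → ℕ → ℝ) (b : ℕ) (v : V) (c : V → B.St × ℕ × Option Msg) : ℝ :=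
  ind (B.Uninformed G b c v) * pot #(senders G (fun w => B.role b (c w).1) v) (c v).2.1

/-- Given the past, `Works.round` contracts the potential of an uninformed receiver. A device that
is not an uninformed receiver never becomes one during the block, because roles do not change and a
stored message is kept; its potential stays 0. -/
theorem expect_potential_le {κ F : ℝ} {pot : ℕ → ℕ → ℝ} (hρ : ρ.Works M G.maxDegree κ F pot)
    {b : ℕ} (hb : b < B.blocks) (v : V) {i : ℕ} (hi : i ≤ ρ.rounds) :
    (𝔼 ω : B.Sample ρ V, B.potential G pot b v
      (B.conf ρ M G s m ((B.toRoundAlg ρ).extend ω) (b * (ρ.rounds + 1) + i))) ≤ κ ^ i * F := by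
  have hdeg : ∀ role : V → Role, #(senders G role v) ≤ G.maxDegree := fun role =>
    (Finset.card_le_card fun w hw => (G.mem_neighborFinset v w).2
      ((mem_senders G role v w).1 hw).1).trans (G.degree_le_maxDegree v)
  have hpot : ∀ k l, 0 ≤ pot k l := fun k l => zero_le_one.trans (hρ.one_le k l)
  have hF : ∀ role : V → Role, 0 < #(senders G role v) → pot #(senders G role v) 0 ≤ F :=
    fun role h => hρ.start _ h (hdeg role)
  induction i with
  | zero =>
    rw [pow_zero, one_mul, add_zero]
    refine Finset.expect_le Finset.univ_nonempty fun ω _ => ?_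
    set c := B.conf ρ M G s m ((B.toRoundAlg ρ).extend ω) (b * (ρ.rounds + 1)) with hc
    by_cases hU : B.Uninformed G b c v
    · have h0 : (c v).2 = (0, none) := conf_start B ρ M G s m _ b v
      rw [potential, ind_of hU, one_mul, h0]
      exact hF _ hU.2.1
    · rw [potential, ind_of_not hU, zero_mul]
      exact hρ.bound_nonneg
  | succ i ih =>
    have hq : b * (ρ.rounds + 1) + i < (B.toRoundAlg ρ).rounds := by
      have : (b + 1) * (ρ.rounds + 1) ≤ B.blocks * (ρ.rounds + 1) := Nat.mul_le_mul_right _ hb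
      have h2 : (B.toRoundAlg ρ).rounds = B.blocks * (ρ.rounds + 1) := rfl
      rw [h2]; nlinarith
    have hstep := (B.toRoundAlg ρ).expect_exec_succ_le M G s m hq
      (fun c => κ * B.potential G pot b v c) (B.potential G pot b v) ?_
    · refine hstep.trans ?_
      rw [← Finset.mul_expect, pow_succ', mul_assoc]
      exact mul_le_mul_of_nonneg_left (ih (by omega)) hρ.nonneg
    · intro ω
      set c : V → B.St × ℕ × Option Msg := B.conf ρ M G s m ((B.toRoundAlg ρ).extend ω)
        (b * (ρ.rounds + 1) + i) with hc
      have hc' : (B.toRoundAlg ρ).exec M G s m ((B.toRoundAlg ρ).extend ω)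
        (b * (ρ.rounds + 1) + i) = c := rfl
      rw [hc']
      have hs : ∀ β w, (B.toRoundAlg ρ).step M G (b * (ρ.rounds + 1) + i) c β w = _ :=
        fun β w => B.step_relay ρ M G (show i < ρ.rounds by omega) c β w
      simp only [potential]
      by_cases hU : B.Uninformed G b c v
      · rw [ind_of hU, one_mul]
        refine le_trans (Finset.expect_le_expect fun β _ => ?_)
          (hρ.round G (fun w => B.role b (c w).1) (fun w => (c w).2.1) v hU.1 hU.2.1 (hdeg _))
        simp only [Uninformed, hs]
        refine mul_le_mul_of_nonneg_right (ind_mono fun h => ?_) (hpot _ _)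
        have := h.2.2
        rw [hU.2.2] at this
        simpa using this
      · rw [ind_of_not hU, zero_mul, mul_zero]
        refine le_of_eq (Finset.expect_eq_zero fun β _ => ?_)
        rw [ind_of_not, zero_mul]
        intro h
        apply hU
        simp only [Uninformed, hs] at h
        refine ⟨h.1, h.2.1, ?_⟩
        have := h.2.2
        rw [Option.or_eq_none_iff] at this
        exact this.1

/-- Markov's inequality: the potential of an uninformed receiver is at least 1. -/
theorem expect_fails_le {κ F : ℝ} {pot : ℕ → ℕ → ℝ} (hρ : ρ.Works M G.maxDegree κ F pot)
    {b : ℕ} (hb : b < B.blocks) (v : V) :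
    (𝔼 ω : B.Sample ρ V, ind (B.Fails ρ M G s m ((B.toRoundAlg ρ).extend ω) b v)) ≤
      κ ^ ρ.rounds * F := by
  refine le_trans (Finset.expect_le_expect fun ω _ => ?_)
    (B.expect_potential_le ρ M G s m hρ hb v le_rfl)
  exact le_mul_of_one_le_right (ind_nonneg _) (hρ.one_le _ _)

end Failure

end BlockAlg

/-! ### Good labelings -/

section Labeling

variable {V : Type*} [Fintype V] [DecidableEq V] (G : SimpleGraph V)

/-- Each vertex whose label is not `0` has a neighbor whose label is smaller by one. -/
def GoodLabeling (L : V → ℕ) : Prop := ∀ v, L v ≠ 0 → ∃ w, G.Adj v w ∧ L w + 1 = L v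

/-- There is a path from `r` to `u` along which the labels go up by one in each step. -/
def Descends (L : V → ℕ) (r u : V) : Prop :=
  Relation.ReflTransGen (fun a b => G.Adj a b ∧ L b = L a + 1) r u

/-- The vertices with label `0`. -/
def roots (L : V → ℕ) : Finset V := {v | L v = 0}

/-- Descendants of `v` and of `r` are adjacent. -/
def Linked (L : V → ℕ) (v r : V) : Prop :=
  ∃ u w, Descends G L v u ∧ Descends G L r w ∧ G.Adj u w

variable {G} {L : V → ℕ}

theorem mem_roots (v : V) : v ∈ roots L ↔ L v = 0 := by simp [roots]

theorem GoodLabeling.exists_root (hL : GoodLabeling G L) (u : V) :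
    ∃ r, L r = 0 ∧ Descends G L r u := by
  induction hk : L u generalizing u with
  | zero => exact ⟨u, hk, Relation.ReflTransGen.refl⟩
  | succ k ih =>
    obtain ⟨w, hw, hlw⟩ := hL u (by omega)
    obtain ⟨r, hr, hd⟩ := ih w (by omega)
    exact ⟨r, hr, hd.tail ⟨hw.symm, hlw.symm⟩⟩

theorem GoodLabeling.exists_label (hL : GoodLabeling G L) (v : V) (k : ℕ) (hk : k ≤ L v) :
    ∃ u, L u = k := by
  induction hd : L v - k generalizing v with
  | zero => exact ⟨v, by omega⟩
  | succ d ih =>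
    obtain ⟨w, _, hlw⟩ := hL v (by omega)
    exact ih w (by omega) (by omega)

/-- All labels from 0 to `L v` occur. Consequently `n` blocks suffice for a pass through the layers.
-/
theorem GoodLabeling.lt_card (hL : GoodLabeling G L) (v : V) : L v < Fintype.card V := by
  have h : range (L v + 1) ⊆ univ.image L := by
    intro k hk
    obtain ⟨u, hu⟩ := hL.exists_label v k (by simpa [Nat.lt_succ_iff] using hk)
    exact Finset.mem_image.2 ⟨u, Finset.mem_univ _, hu⟩
  have := (Finset.card_le_card h).trans Finset.card_image_le
  simpa using this

theorem Descends.eq_or_lt {r u : V} (h : Descends G L r u) : u = r ∨ L r < L u := by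
  induction h with
  | refl => exact Or.inl rfl
  | tail _ hbc ih =>
    right
    rcases ih with rfl | ih
    · omega
    · omega

/-- Walk from `v` to another root, which is no descendant of `v` since its label is 0. Where the
walk leaves the descendants of `v`, it enters a vertex that descends from some root, and that root
cannot be `v`. -/
theorem GoodLabeling.exists_linked (hL : GoodLabeling G L) (hG : G.Connected) {v : V}
    (h2 : 2 ≤ #(roots L)) (hv : L v = 0) : ∃ r, r ≠ v ∧ L r = 0 ∧ Linked G L v r := by
  obtain ⟨r', hr', hne⟩ := Finset.exists_mem_ne (by omega : 1 < #(roots L)) v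
  rw [mem_roots] at hr'
  have hr'D : ¬ Descends G L v r' := by
    intro h
    rcases h.eq_or_lt with h | h
    · exact hne h
    · omega
  obtain ⟨p⟩ := hG.preconnected v r'
  obtain ⟨d, _, hd1, hd2⟩ := p.exists_boundary_dart {u | Descends G L v u}
    Relation.ReflTransGen.refl hr'D
  obtain ⟨r, hr, hd⟩ := hL.exists_root d.snd
  refine ⟨r, ?_, hr, d.fst, d.snd, hd1, hd, d.adj⟩
  rintro rfl
  exact hd2 hd

end Labeling

/-! ### The schedule of a phase -/

/-- Whether in block `k` of a phase the devices with label `l` may send. Blocks `1, …, n` go down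
the layers, block `n + 1` is for all devices, the next `n` blocks go up the layers, and the last
`n` blocks go down again. -/
def Sends (n k l : ℕ) : Prop :=
  (1 ≤ k ∧ k ≤ n ∧ l + 1 = k) ∨ k = n + 1 ∨ (n + 2 ≤ k ∧ k ≤ 2 * n + 1 ∧ l + k = 2 * n + 2) ∨
    (2 * n + 2 ≤ k ∧ l + (2 * n + 2) = k)

/-- Whether in block `k` of a phase the devices with label `l` may receive. -/
def Receives (n k l : ℕ) : Prop :=
  (1 ≤ k ∧ k ≤ n ∧ l = k) ∨ k = n + 1 ∨ (n + 2 ≤ k ∧ k ≤ 2 * n + 1 ∧ l + k = 2 * n + 1) ∨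
    (2 * n + 2 ≤ k ∧ l + (2 * n + 1) = k)

instance (n k l : ℕ) : Decidable (Sends n k l) := by unfold Sends; infer_instance

instance (n k l : ℕ) : Decidable (Receives n k l) := by unfold Receives; infer_instance

section Phase

variable {V : Type*} [Fintype V] [DecidableEq V] (G : SimpleGraph V)

/-- The contents of the registers at the beginning of the blocks of a phase, given
the labels `L`. A device whose register is in use sends its content `x` according to the schedule,
and one that hears `x` writes `true :: x`. -/
structure IsPhase (L : V → ℕ) (reg : ℕ → V → Option Msg) : Prop where
  keep : ∀ k v x, 1 ≤ k → k < 3 * Fintype.card V + 2 → reg k v = some x → reg (k + 1) v = some x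
  sound : ∀ k v x, 1 ≤ k → k < 3 * Fintype.card V + 2 → reg k v = none →
    reg (k + 1) v = some x → Receives (Fintype.card V) k (L v) ∧
      ∃ w y, G.Adj v w ∧ reg k w = some y ∧ x = true :: y
  complete : ∀ k v w, 1 ≤ k → k < 3 * Fintype.card V + 2 → G.Adj v w →
    Receives (Fintype.card V) k (L v) → Sends (Fintype.card V) k (L w) → reg k w ≠ none →
    reg (k + 1) v ≠ none

namespace IsPhase

variable {G} {L : V → ℕ} {reg : ℕ → V → Option Msg} (h : IsPhase G L reg)
include h

theorem keep_le {i k : ℕ} {v : V} {x : Msg} (hi : 1 ≤ i) (hik : i ≤ k)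
    (hk : k ≤ 3 * Fintype.card V + 2) (hx : reg i v = some x) : reg k v = some x := by
  induction k, hik using Nat.le_induction with
  | base => exact hx
  | succ k hik ih => exact h.keep k v x (by omega) (by omega) (ih (by omega))

theorem ne_none_le {i k : ℕ} {v : V} (hi : 1 ≤ i) (hik : i ≤ k)
    (hk : k ≤ 3 * Fintype.card V + 2) (hx : reg i v ≠ none) : reg k v ≠ none := by
  obtain ⟨x, hx⟩ := Option.ne_none_iff_exists'.1 hx
  rw [h.keep_le hi hik hk hx]
  simp

/-- Registers in use never change, so the neighbor from which `x` was learned still holds `y` at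
time `k`. This neighbor is the parent in the new labeling. -/
theorem origin {k : ℕ} {v : V} {x : Msg} (hk1 : 1 ≤ k) (hk : k ≤ 3 * Fintype.card V + 2)
    (hx : reg k v = some x) :
    reg 1 v = some x ∨ ∃ w y, G.Adj v w ∧ reg k w = some y ∧ x = true :: y := by
  induction k, hk1 using Nat.le_induction generalizing v x with
  | base => exact Or.inl hx
  | succ k hk1 ih =>
    cases hr : reg k v with
    | none =>
      obtain ⟨_, w, y, hvw, hy, hxy⟩ := h.sound k v x hk1 (by omega) hr hx
      exact Or.inr ⟨w, y, hvw, h.keep k w y hk1 (by omega) hy, hxy⟩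
    | some z =>
      have hz := h.keep k v z hk1 (by omega) hr
      rw [hx] at hz
      obtain rfl := Option.some.inj hz
      rcases ih (by omega) hr with h1 | ⟨w, y, hvw, hy, hxy⟩
      · exact Or.inl h1
      · exact Or.inr ⟨w, y, hvw, h.keep k w y hk1 (by omega) hy, hxy⟩

/-- A property that the registers have in the beginning and that is preserved by
`true :: ·` holds throughout. -/
theorem forall_reg (p : Msg → Prop) (hp : ∀ x, p x → p (true :: x))
    (h1 : ∀ v x, reg 1 v = some x → p x) {k : ℕ} (hk1 : 1 ≤ k)
    (hk : k ≤ 3 * Fintype.card V + 2) {v : V} {x : Msg} (hx : reg k v = some x) : p x := by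
  induction k, hk1 using Nat.le_induction generalizing v x with
  | base => exact h1 v x hx
  | succ k hk1 ih =>
    cases hr : reg k v with
    | none =>
      obtain ⟨_, w, y, _, hy, rfl⟩ := h.sound k v x hk1 (by omega) hr hx
      exact hp y (ih (by omega) hy)
    | some z =>
      have hz := h.keep k v z hk1 (by omega) hr
      rw [hx] at hz
      obtain rfl := Option.some.inj hz
      exact ih (by omega) hr

/-- The wave moves one layer per block: a descendant in layer `l` is reached by the beginning of
block `l + 1`, just when its layer has to send. -/
theorem down {r u : V} (hL : GoodLabeling G L) (hr : L r = 0) (hd : Descends G L r u)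
    (h1 : reg 1 r ≠ none) : reg (L u + 1) u ≠ none := by
  induction hd with
  | refl => rwa [hr]
  | tail _ hbc ih =>
    rename_i b c _
    have hc := hL.lt_card c
    refine h.complete (L c) c b (by omega) (by omega) hbc.1.symm ?_ ?_ ?_
    · left; omega
    · left; omega
    · rw [hbc.2]; exact ih

theorem cross {u w : V} (huw : G.Adj u w) (hw : reg (Fintype.card V + 1) w ≠ none) :
    reg (Fintype.card V + 2) u ≠ none :=
  h.complete _ u w (by omega) (by omega) huw (by right; left; rfl) (by right; left; rfl) hw

/-- In block `2n + 2 - l` layer `l` sends and layer `l - 1` receives, so induction along the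
descent, from `u` back to `a`, follows the schedule. -/
theorem up {a u : V} (hL : GoodLabeling G L) (hd : Descends G L a u)
    (hu : reg (2 * Fintype.card V + 2 - L u) u ≠ none) :
    reg (2 * Fintype.card V + 2 - L a) a ≠ none := by
  induction hd using Relation.ReflTransGen.head_induction_on with
  | refl => exact hu
  | head hbc _ ih =>
    rename_i b c _
    have hc := hL.lt_card c
    have hb := hbc.2
    have he : 2 * Fintype.card V + 2 - L b = 2 * Fintype.card V + 2 - L c + 1 := by omega
    rw [he]
    refine h.complete _ b c (by omega) (by omega) hbc.1 ?_ ?_ ih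
    · right; right; left; omega
    · right; right; left; omega

theorem up_root {a u : V} (hL : GoodLabeling G L) (ha : L a = 0) (hd : Descends G L a u)
    (hu : reg (Fintype.card V + 2) u ≠ none) : reg (2 * Fintype.card V + 2) a ≠ none := by
  have hlu := hL.lt_card u
  have := h.up hL hd (h.ne_none_le (by omega) (by omega) (by omega) hu)
  rwa [ha] at this

theorem down_again {r u : V} (hL : GoodLabeling G L) (hr : L r = 0) (hd : Descends G L r u)
    (h1 : reg (2 * Fintype.card V + 2) r ≠ none) :
    reg (2 * Fintype.card V + 2 + L u) u ≠ none := by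
  induction hd with
  | refl => rwa [hr]
  | tail _ hbc ih =>
    rename_i b c _
    have hc := hL.lt_card c
    have hb := hbc.2
    have he : 2 * Fintype.card V + 2 + L c = 2 * Fintype.card V + 2 + L b + 1 := by omega
    rw [he]
    refine h.complete _ c b (by omega) (by omega) hbc.1.symm ?_ ?_ ih
    · right; right; right; omega
    · right; right; right; omega

/-- This is what the second downward pass achieves: if the parent `w` were in use at its sending
block `k`, then `v` would have been reached. After `k` the layer of `w` receives no more, so `w`
stays empty to the end. -/
theorem none_last {v w : V} (hL : GoodLabeling G L) (hvw : G.Adj v w) (hl : L w + 1 = L v)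
    (hv : reg (3 * Fintype.card V + 2) v = none) : reg (3 * Fintype.card V + 2) w = none := by
  have hlv := hL.lt_card v
  set k := 2 * Fintype.card V + 2 + L w with hk
  have hkw : reg k w = none := by
    by_contra hne
    have h1 := h.complete k v w (by omega) (by omega) hvw (by right; right; right; omega)
      (by right; right; right; omega) hne
    exact h.ne_none_le (by omega) (by omega) le_rfl h1 hv
  have : ∀ i, k ≤ i → i ≤ 3 * Fintype.card V + 2 → reg i w = none := by
    intro i hki
    induction i, hki using Nat.le_induction with
    | base => exact fun _ => hkw
    | succ i hki ih =>
      intro hi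
      by_contra hne
      obtain ⟨x, hx⟩ := Option.ne_none_iff_exists'.1 hne
      obtain ⟨hrec, _⟩ := h.sound i w x (by omega) (by omega) (ih (by omega)) hx
      unfold Receives at hrec
      omega
  exact this _ (by omega) le_rfl

/-- The labels after a phase. -/
theorem good {L' : V → ℕ} (hL : GoodLabeling G L)
    (h1 : ∀ v x, reg 1 v = some x → x = [])
    (hL' : ∀ v, L' v = ((reg (3 * Fintype.card V + 2) v).map List.length).getD (L v)) :
    GoodLabeling G L' := by
  intro v hv
  cases hr : reg (3 * Fintype.card V + 2) v with
  | none =>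
    rw [hL' v, hr] at hv
    -- A vertex that is not reached keeps its label, and by `none_last` its old parent does too.
    obtain ⟨w, hvw, hl⟩ := hL v (by simpa using hv)
    refine ⟨w, hvw, ?_⟩
    rw [hL', hL', hr, h.none_last hL hvw hl hr]
    simpa using hl
  | some x =>
    rcases h.origin (by omega) le_rfl hr with hx | ⟨w, y, hvw, hy, rfl⟩
    · rw [hL' v, hr, h1 v x hx] at hv
      simp at hv
    -- The neighbor's register is shorter by one symbol, and register lengths are the new labels.
    · refine ⟨w, hvw, ?_⟩
      rw [hL', hL', hr, hy]
      simp

theorem root_of_root {L' : V → ℕ} (h1 : ∀ v x, reg 1 v = some x → L v = 0)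
    (hL' : ∀ v, L' v = ((reg (3 * Fintype.card V + 2) v).map List.length).getD (L v))
    {v : V} (hv : L' v = 0) : L v = 0 := by
  rw [hL'] at hv
  cases hr : reg (3 * Fintype.card V + 2) v with
  | none => simpa [hr] using hv
  | some x =>
    rcases h.origin (by omega) le_rfl hr with hx | ⟨w, y, hvw, hy, rfl⟩
    · exact h1 v x hx
    · simp [hr] at hv

/-- A root whose register was not in use in the beginning is no root after the phase if it is
linked to a root whose register was in use. -/
theorem not_root {L' : V → ℕ} (hL : GoodLabeling G L)
    (hL' : ∀ v, L' v = ((reg (3 * Fintype.card V + 2) v).map List.length).getD (L v))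
    {v r : V} (hv : L v = 0) (hr : L r = 0) (hlink : Linked G L v r) (hrv : reg 1 v = none)
    (hrr : reg 1 r ≠ none) : L' v ≠ 0 := by
  obtain ⟨u, w, hu, hw, huw⟩ := hlink
  have hlw := hL.lt_card w
  -- The wave of `r` descends to `w`, crosses to `u` in block `n + 1`, and climbs to `v`.
  have h1 := h.ne_none_le (k := Fintype.card V + 1) (by omega) (by omega) (by omega)
    (h.down hL hr hw hrr)
  have h2 := h.up_root hL hv hu (h.cross huw h1)
  have h3 := h.ne_none_le (k := 3 * Fintype.card V + 2) (by omega) (by omega) (by omega) h2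
  obtain ⟨x, hx⟩ := Option.ne_none_iff_exists'.1 h3
  -- The register of `v` was empty at first, so its content begins with `true` and has positive
  -- length.
  rcases h.origin (by omega) le_rfl hx with h4 | ⟨w, y, hvw, hy, rfl⟩
  · rw [hrv] at h4
    simp at h4
  · rw [hL', hx]
    simp

/-- If there is one root only, then everyone is informed of what one device knows. -/
theorem informs (hL : GoodLabeling G L) (hroot : #(roots L) ≤ 1) {s : V} (hs : reg 1 s ≠ none)
    (v : V) : reg (3 * Fintype.card V + 2) v ≠ none := by
  obtain ⟨r, hr, hd⟩ := hL.exists_root s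
  obtain ⟨r', hr', hd'⟩ := hL.exists_root v
  obtain rfl : r = r' := Finset.card_le_one.1 hroot r ((mem_roots r).2 hr) r' ((mem_roots r').2 hr')
  have hlv := hL.lt_card v
  -- The register of `s` stays in use until the upward pass; the first downward pass and the
  -- crossing block are not needed here.
  have h1 := h.up_root hL hr hd (h.ne_none_le (by omega) (by omega) (by omega) hs)
  exact h.ne_none_le (by omega) (by omega) le_rfl (h.down_again hL hr hd' h1)

end IsPhase

end Phase

/-! ### The broadcast algorithm -/

/-- The state of a device: its label, its register, and its input. -/
structure DevState where
  /-- the label in the current phase -/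
  lab : ℕ
  /-- the register -/
  reg : Option Msg
  /-- the input -/
  src : Option Msg

/-- The label in the next phase: if the register is in use, then its length. -/
def DevState.label (x : DevState) : ℕ := (x.reg.map List.length).getD x.lab

/-- The broadcast algorithm. In each of the first `P` phases, each root starts with an empty
register with probability `1 / 2`, and a new labeling is computed. In the last phase, the message of
the source is broadcast along the labeling. -/
def broadcastAlg (n P : ℕ) : BlockAlg where
  blocks := (P + 1) * (3 * n + 2)
  St := DevState
  init i := ⟨0, none, i⟩
  role b x :=
    match x.reg with
    | some y => if Sends n (b % (3 * n + 2)) x.lab then .send y else .idle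
    | none => if Receives n (b % (3 * n + 2)) x.lab then .recv else .idle
  next b x got coin :=
    -- Block 0 of a phase is silent and only resets labels and registers; hence registers are
    -- considered from block 1 on. The bit `false` separates the hop count from the message, which
    -- may itself begin with `true`.
    if b % (3 * n + 2) = 0 then
      ⟨x.label,
        if b / (3 * n + 2) < P then (if x.label = 0 ∧ coin = true then some [] else none)
        else x.src.map (false :: ·), x.src⟩
    else ⟨x.lab, x.reg.or (got.map (true :: ·)), x.src⟩
  out x := x.reg.map fun y => (y.dropWhile id).tail

section Analysis

variable {V : Type} [Fintype V] [DecidableEq V] (P : ℕ) (ρ : Relay) (M : Model)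
  (G : SimpleGraph V) [DecidableRel G.Adj] (s : V) (m : Msg)
  (τ : ℕ → V → Fin (ρ.len + 1) → Bool)

/-- The state of a device at the beginning of a block of the broadcast algorithm. -/
noncomputable def devState (b : ℕ) (v : V) : DevState :=
  (broadcastAlg (Fintype.card V) P).state ρ M G s m τ b v

/-- The label of a device in phase `p`. -/
noncomputable def phaseLabel (p : ℕ) (v : V) : ℕ :=
  (devState P ρ M G s m τ (p * (3 * Fintype.card V + 2)) v).label

/-- The failure of `v` to receive a message in block `b` of the broadcast algorithm. -/
def DevFails (b : ℕ) (v : V) : Prop :=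
  (broadcastAlg (Fintype.card V) P).Fails ρ M G s m τ b v

theorem devState_succ (b : ℕ) (v : V) :
    devState P ρ M G s m τ (b + 1) v = (broadcastAlg (Fintype.card V) P).next b
      (devState P ρ M G s m τ b v) ((broadcastAlg (Fintype.card V) P).got ρ M G s m τ b v)
      (BlockAlg.coin ρ τ b v) :=
  BlockAlg.state_succ _ ρ M G s m τ b v

theorem devState_zero (v : V) :
    devState P ρ M G s m τ 0 v = ⟨0, none, if v = s then some m else none⟩ := by
  simp only [devState, BlockAlg.state, Nat.zero_mul]
  rfl

theorem devState_src (b : ℕ) (v : V) :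
    (devState P ρ M G s m τ b v).src = if v = s then some m else none := by
  induction b with
  | zero => rw [devState_zero]
  | succ b ih =>
    rw [devState_succ, ← ih]
    simp only [broadcastAlg]
    split_ifs <;> rfl

theorem phase_mod {n p k : ℕ} (hk : k < 3 * n + 2) :
    (p * (3 * n + 2) + k) % (3 * n + 2) = k := by
  rw [add_comm, Nat.add_mul_mod_self_right, Nat.mod_eq_of_lt hk]

theorem devState_one (p : ℕ) (v : V) :
    devState P ρ M G s m τ (p * (3 * Fintype.card V + 2) + 1) v =
      ⟨phaseLabel P ρ M G s m τ p v,
        if p < P then (if phaseLabel P ρ M G s m τ p v = 0 ∧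
          BlockAlg.coin ρ τ (p * (3 * Fintype.card V + 2)) v = true then some [] else none)
        else (if v = s then some m else none).map (false :: ·), if v = s then some m else none⟩ := by
  have h1 : (p * (3 * Fintype.card V + 2)) % (3 * Fintype.card V + 2) = 0 := Nat.mul_mod_left _ _
  have h2 : (p * (3 * Fintype.card V + 2)) / (3 * Fintype.card V + 2) = p :=
    Nat.mul_div_cancel _ (by omega)
  rw [devState_succ, ← devState_src P ρ M G s m τ (p * (3 * Fintype.card V + 2)) v]
  simp only [broadcastAlg, h1, h2, if_true]
  rfl

theorem devState_step {p k : ℕ} (hk1 : 1 ≤ k) (hk : k < 3 * Fintype.card V + 2) (v : V) :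
    devState P ρ M G s m τ (p * (3 * Fintype.card V + 2) + (k + 1)) v =
      ⟨(devState P ρ M G s m τ (p * (3 * Fintype.card V + 2) + k) v).lab,
        (devState P ρ M G s m τ (p * (3 * Fintype.card V + 2) + k) v).reg.or
          (((broadcastAlg (Fintype.card V) P).got ρ M G s m τ
            (p * (3 * Fintype.card V + 2) + k) v).map (true :: ·)),
        (devState P ρ M G s m τ (p * (3 * Fintype.card V + 2) + k) v).src⟩ := by
  rw [← add_assoc, devState_succ]
  simp only [broadcastAlg, phase_mod hk]
  rw [if_neg (by omega)]

theorem devState_lab {p k : ℕ} (hk1 : 1 ≤ k) (hk : k ≤ 3 * Fintype.card V + 2) (v : V) :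
    (devState P ρ M G s m τ (p * (3 * Fintype.card V + 2) + k) v).lab =
      phaseLabel P ρ M G s m τ p v := by
  induction k, hk1 using Nat.le_induction with
  | base => rw [devState_one]
  | succ k hk1 ih =>
    rw [devState_step P ρ M G s m τ hk1 (by omega)]
    exact ih (by omega)

/-- The content of a register in a phase. -/
noncomputable def phaseReg (p k : ℕ) (v : V) : Option Msg :=
  (devState P ρ M G s m τ (p * (3 * Fintype.card V + 2) + k) v).reg

theorem phaseLabel_succ (p : ℕ) (v : V) :
    phaseLabel P ρ M G s m τ (p + 1) v =
      ((phaseReg P ρ M G s m τ p (3 * Fintype.card V + 2) v).map List.length).getD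
        (phaseLabel P ρ M G s m τ p v) := by
  conv_lhs => rw [phaseLabel, Nat.succ_mul, DevState.label]
  rw [devState_lab P ρ M G s m τ (by omega) le_rfl]
  rfl

theorem role_phase {p k : ℕ} (hk1 : 1 ≤ k) (hk : k < 3 * Fintype.card V + 2) (v : V) :
    (broadcastAlg (Fintype.card V) P).role (p * (3 * Fintype.card V + 2) + k)
      (devState P ρ M G s m τ (p * (3 * Fintype.card V + 2) + k) v) =
    match phaseReg P ρ M G s m τ p k v with
    | some y => if Sends (Fintype.card V) k (phaseLabel P ρ M G s m τ p v) then .send y else .idle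
    | none => if Receives (Fintype.card V) k (phaseLabel P ρ M G s m τ p v) then .recv
        else .idle := by
  simp only [broadcastAlg, phase_mod hk, devState_lab P ρ M G s m τ hk1 hk.le]
  rfl

/-- Failures can only delay information, never falsify it: `keep` and `sound` hold in every run, and
only `complete` uses `hok`. -/
theorem isPhase {p : ℕ} (hok : ∀ k < 3 * Fintype.card V + 2, ∀ v,
      ¬ DevFails P ρ M G s m τ (p * (3 * Fintype.card V + 2) + k) v) :
    IsPhase G (phaseLabel P ρ M G s m τ p) (phaseReg P ρ M G s m τ p) where
  keep k v x hk1 hk hx := by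
    unfold phaseReg at hx ⊢
    rw [devState_step P ρ M G s m τ hk1 hk, hx]
    rfl
  sound k v x hk1 hk hx hx' := by
    have hx0 := hx
    unfold phaseReg at hx hx'
    rw [devState_step P ρ M G s m τ hk1 hk, hx] at hx'
    simp only [Option.none_or, Option.map_eq_some_iff] at hx'
    obtain ⟨y, hy, rfl⟩ := hx'
    obtain ⟨hv, w, hvw, hw⟩ := BlockAlg.got_sound _ ρ M G s m τ hy
    have h1 := role_phase P ρ M G s m τ (p := p) hk1 hk v
    have h2 := role_phase P ρ M G s m τ (p := p) hk1 hk w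
    rw [devState, hv, hx0] at h1
    rw [devState, hw] at h2
    refine ⟨?_, w, y, hvw, ?_, rfl⟩
    · by_contra hn
      simp [hn] at h1
    · cases hr : phaseReg P ρ M G s m τ p k w with
      | none =>
        rw [hr] at h2
        simp only at h2
        split_ifs at h2
      | some z =>
        rw [hr] at h2
        simp only at h2
        split_ifs at h2
        rw [Role.send.injEq] at h2
        rw [h2]
  complete k v w hk1 hk hvw hrec hsend hw := by
    unfold phaseReg
    rw [devState_step P ρ M G s m τ hk1 hk]
    intro hn
    rw [Option.or_eq_none_iff, Option.map_eq_none_iff] at hn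
    obtain ⟨y, hy⟩ := Option.ne_none_iff_exists'.1 hw
    have h1 := role_phase P ρ M G s m τ (p := p) hk1 hk v
    have h2 := role_phase P ρ M G s m τ (p := p) hk1 hk w
    have h3 : phaseReg P ρ M G s m τ p k v = none := hn.1
    rw [h3] at h1
    rw [hy] at h2
    simp only [hrec, hsend, if_true] at h1 h2
    exact BlockAlg.got_ne_none _ ρ M G s m τ (hok k hk v) hvw h1 ⟨y, h2⟩ hn.2

theorem phaseReg_one (p : ℕ) (v : V) : phaseReg P ρ M G s m τ p 1 v =
    if p < P then (if phaseLabel P ρ M G s m τ p v = 0 ∧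
      BlockAlg.coin ρ τ (p * (3 * Fintype.card V + 2)) v = true then some [] else none)
    else (if v = s then some m else none).map (false :: ·) := by
  rw [phaseReg, devState_one]

/-- No device fails in the blocks before block `b`. -/
def NoFailure (b : ℕ) : Prop := ∀ i < b, ∀ v, ¬ DevFails P ρ M G s m τ i v

variable {P ρ M G s m τ}

theorem NoFailure.mono {b b' : ℕ} (h : NoFailure P ρ M G s m τ b') (hb : b ≤ b') :
    NoFailure P ρ M G s m τ b := fun i hi v => h i (by omega) v

theorem NoFailure.isPhase {p : ℕ}
    (h : NoFailure P ρ M G s m τ ((p + 1) * (3 * Fintype.card V + 2))) :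
    IsPhase G (phaseLabel P ρ M G s m τ p) (phaseReg P ρ M G s m τ p) := by
  refine RadioNetwork.isPhase P ρ M G s m τ fun k hk v => h _ ?_ v
  rw [add_one_mul p]
  omega

theorem NoFailure.good {p : ℕ} (hp : p ≤ P)
    (h : NoFailure P ρ M G s m τ (p * (3 * Fintype.card V + 2))) :
    GoodLabeling G (phaseLabel P ρ M G s m τ p) := by
  induction p with
  | zero =>
    intro v hv
    exfalso
    apply hv
    rw [phaseLabel, Nat.zero_mul, devState_zero]
    rfl
  | succ p ih =>
    refine h.isPhase.good (ih (by omega) (h.mono (Nat.mul_le_mul_right _ (by omega)))) ?_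
      (phaseLabel_succ P ρ M G s m τ p)
    intro v x hx
    rw [phaseReg_one, if_pos (by omega)] at hx
    split_ifs at hx
    simpa using hx.symm

theorem NoFailure.succeeds
    (h : NoFailure P ρ M G s m τ ((P + 1) * (3 * Fintype.card V + 2)))
    (hroot : #(roots (phaseLabel P ρ M G s m τ P)) ≤ 1) (v : V) :
    (broadcastAlg (Fintype.card V) P).out
      (devState P ρ M G s m τ ((P + 1) * (3 * Fintype.card V + 2)) v) = some m := by
  have hph := h.isPhase
  have hL := NoFailure.good le_rfl (h.mono (Nat.mul_le_mul_right _ (by omega)))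
  have hs : phaseReg P ρ M G s m τ P 1 s ≠ none := by
    rw [phaseReg_one]; simp
  obtain ⟨x, hx⟩ := Option.ne_none_iff_exists'.1 (hph.informs hL hroot hs v)
  -- Prepending `true` does not change what `dropWhile id` leaves.
  have hmsg := hph.forall_reg (fun x => x.dropWhile id = false :: m) (fun x hx => by simpa using hx)
    (fun v x hx => by
      rw [phaseReg_one, if_neg (lt_irrefl _)] at hx
      split_ifs at hx
      · simp only [Option.map_some, Option.some.injEq] at hx
        rw [← hx]
        simp
      · simp at hx) (by omega) le_rfl hx
  rw [phaseReg] at hx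
  rw [Nat.succ_mul]
  simp only [broadcastAlg, hx, Option.map_some, hmsg, List.tail_cons]

variable (P ρ M G s m τ)

-- Layer `l` sends in blocks `l + 1`, `n + 1`, `2n + 2 - l`, `2n + 2 + l` and receives in blocks
-- `l`, `n + 1`, `2n + 1 - l`, `2n + 1 + l`; block `n + 1` is common to both lists, so seven remain.
open Classical in
theorem card_active_le (v : V) :
    #{b ∈ range (broadcastAlg (Fintype.card V) P).blocks | (broadcastAlg (Fintype.card V) P).role b
      ((broadcastAlg (Fintype.card V) P).state ρ M G s m τ b v) ≠ Role.idle} ≤ (P + 1) * 7 := by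
  change #{b ∈ range ((P + 1) * (3 * Fintype.card V + 2)) |
    (broadcastAlg (Fintype.card V) P).role b (devState P ρ M G s m τ b v) ≠ Role.idle} ≤ _
  set n := Fintype.card V with hn
  rw [Finset.card_filter, RoundAlg.sum_range_mul_eq]
  refine (Finset.sum_le_card_nsmul _ _ 7 fun p _ => ?_).trans (by simp)
  rw [← Finset.card_filter]
  set l := phaseLabel P ρ M G s m τ p v with hl
  refine (Finset.card_le_card (t := {l + 1, l, n + 1, 2 * n + 2 - l, 2 * n + 1 - l, l + (2 * n + 2),
    l + (2 * n + 1)}) fun k hk => ?_).trans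
      ((Finset.card_insert_le _ _).trans (Nat.succ_le_succ Finset.card_le_six))
  rw [Finset.mem_filter, Finset.mem_range] at hk
  obtain ⟨hk, hne⟩ := hk
  have hSR : Sends n k l ∨ Receives n k l := by
    by_contra hcon
    rw [not_or] at hcon
    apply hne
    rcases Nat.eq_zero_or_pos k with rfl | hk1
    · simp only [broadcastAlg, phase_mod hk]
      have h1 : ∀ l, ¬ Sends n 0 l := fun l h => by unfold Sends at h; omega
      have h2 : ∀ l, ¬ Receives n 0 l := fun l h => by unfold Receives at h; omega
      split <;> simp [h1, h2]
    · rw [role_phase P ρ M G s m τ hk1 hk]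
      split
      · rw [if_neg hcon.1]
      · rw [if_neg hcon.2]
  simp only [Finset.mem_insert, Finset.mem_singleton]
  unfold Sends Receives at hSR
  omega

end Analysis

/-! ### The number of roots goes down -/

section Roots

variable {V : Type} [Fintype V] [DecidableEq V] (P : ℕ) (ρ : Relay) (M : Model)
  (G : SimpleGraph V) [DecidableRel G.Adj] (s : V) (m : Msg)

/-- The number of roots, if there are at least two of them, and `0` otherwise. -/
noncomputable def excess (L : V → ℕ) : ℝ := if 2 ≤ #(roots L) then (#(roots L) : ℝ) else 0

/-- The number of roots that are not linked, with bit `false`, to a root with bit `true`. -/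
noncomputable def survivors (L : V → ℕ) (coin : V → Bool) : ℝ :=
  ∑ v ∈ roots L, ind (¬ ∃ r, L r = 0 ∧ Linked G L v r ∧ coin v = false ∧ coin r = true)

theorem excess_nonneg (L : V → ℕ) : 0 ≤ excess L := by
  unfold excess; split_ifs <;> positivity

theorem excess_le (L : V → ℕ) : excess L ≤ #(roots L) := by
  unfold excess; split_ifs
  · exact le_rfl
  · positivity

theorem survivors_nonneg (L : V → ℕ) (coin : V → Bool) : 0 ≤ survivors G L coin :=
  Finset.sum_nonneg fun _ _ => ind_nonneg _

theorem expect_ind_bit (k : ℕ) (b : Bool) : (𝔼 a : Fin (k + 1) → Bool, ind (a 0 = b)) = 1 / 2 := by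
  have h := expect_ind_forall (ι := Fin (k + 1)) {0} (fun _ a => a = b)
  simp only [Finset.mem_singleton, forall_eq, Finset.prod_singleton] at h
  rw [h, Finset.expect_eq_sum_div_card]
  cases b <;> simp [ind]

theorem expect_ind_pair (k : ℕ) {v r : V} (hr : r ≠ v) :
    (𝔼 β : V → Fin (k + 1) → Bool, ind (β v 0 = false ∧ β r 0 = true)) = 1 / 4 := by
  have h := expect_ind_forall (ι := V) {v, r}
    (fun i (a : Fin (k + 1) → Bool) => a 0 = if i = v then false else true)
  rw [Finset.prod_pair hr.symm] at h
  simp only [Finset.mem_insert, Finset.mem_singleton, forall_eq_or_imp, forall_eq, if_true, hr,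
    if_false, expect_ind_bit] at h
  rw [h]
  norm_num

/-- For each root one linked partner is enough: the coins are `false` at `v` and `true` at the
partner with probability 1/4. Linearity of expectation makes dependence between roots harmless. -/
theorem expect_survivors_le (k : ℕ) {L : V → ℕ} (hL : GoodLabeling G L) (hG : G.Connected)
    (h2 : 2 ≤ #(roots L)) :
    (𝔼 β : V → Fin (k + 1) → Bool, survivors G L fun v => β v 0) ≤ 3 / 4 * #(roots L) := by
  unfold survivors
  rw [Finset.expect_sum_comm]
  refine (Finset.sum_le_card_nsmul _ _ (3 / 4) fun v hv => ?_).trans (le_of_eq ?_)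
  · obtain ⟨r, hr, hr0, hlink⟩ := hL.exists_linked hG h2 ((mem_roots v).1 hv)
    calc _ ≤ 𝔼 β : V → Fin (k + 1) → Bool, ind (¬ (β v 0 = false ∧ β r 0 = true)) :=
          Finset.expect_le_expect fun β _ => ind_mono fun h hc => h ⟨r, hr0, hlink, hc⟩
      _ = 3 / 4 := by
          rw [expect_ind_not (fun β : V → Fin (k + 1) → Bool => β v 0 = false ∧ β r 0 = true),
            expect_ind_pair k hr]
          norm_num
  · rw [nsmul_eq_mul, mul_comm]

/-- On the right only the coins belong to phase `p`; labels and failures there are settled before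
the coins are tossed, so the coins can be averaged separately. No root is ever created, so an excess
of 0 stays 0. -/
theorem excess_succ_le (τ : ℕ → V → Fin (ρ.len + 1) → Bool) {p : ℕ} (hp : p < P) :
    ind (NoFailure P ρ M G s m τ ((p + 1) * (3 * Fintype.card V + 2))) *
      excess (phaseLabel P ρ M G s m τ (p + 1)) ≤
    ind (NoFailure P ρ M G s m τ (p * (3 * Fintype.card V + 2))) *
      if 2 ≤ #(roots (phaseLabel P ρ M G s m τ p)) then
        survivors G (phaseLabel P ρ M G s m τ p)
          (BlockAlg.coin ρ τ (p * (3 * Fintype.card V + 2))) else 0 := by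
  by_cases h : NoFailure P ρ M G s m τ ((p + 1) * (3 * Fintype.card V + 2))
  · have h0 := h.mono (b := p * (3 * Fintype.card V + 2)) (Nat.mul_le_mul_right _ (by omega))
    rw [ind_of h, ind_of h0, one_mul, one_mul]
    have hL := h0.good hp.le
    have hph := h.isPhase
    have hsub : roots (phaseLabel P ρ M G s m τ (p + 1)) ⊆ roots (phaseLabel P ρ M G s m τ p) := by
      intro v hv
      rw [mem_roots] at hv ⊢
      refine hph.root_of_root (fun v x hx => ?_) (phaseLabel_succ P ρ M G s m τ p) hv
      rw [phaseReg_one, if_pos hp] at hx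
      split_ifs at hx with hc
      exact hc.1
    have hcard := Finset.card_le_card hsub
    by_cases h2 : 2 ≤ #(roots (phaseLabel P ρ M G s m τ p))
    · rw [if_pos h2]
      refine (excess_le _).trans ?_
      unfold survivors
      rw [← nsmul_one, ← Finset.sum_const]
      refine le_trans (Finset.sum_le_sum fun v hv => ?_)
        (Finset.sum_le_sum_of_subset_of_nonneg hsub fun v _ _ => ind_nonneg _)
      rw [ind_of]
      rintro ⟨r, hr0, hlink, hcv, hcr⟩
      have hv0 := (mem_roots v).1 (hsub hv)
      refine hph.not_root hL (phaseLabel_succ P ρ M G s m τ p) hv0 hr0 hlink ?_ ?_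
        ((mem_roots v).1 hv)
      · rw [phaseReg_one, if_pos hp, if_neg]
        rw [hcv]
        simp
      · rw [phaseReg_one, if_pos hp, if_pos ⟨hr0, hcr⟩]
        simp
    · rw [if_neg h2, excess, if_neg (by omega)]
  · rw [ind_of_not h, zero_mul]
    refine mul_nonneg (ind_nonneg _) ?_
    split_ifs
    · exact survivors_nonneg _ _ _
    · exact le_rfl

/-- The sample space of the broadcast algorithm. -/
abbrev DevSample (V : Type) [Fintype V] : Type :=
  (broadcastAlg (Fintype.card V) P).Sample ρ V

/-- The random bits of all rounds in an outcome of the sample space. -/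
noncomputable abbrev DevSample.tape (ω : DevSample P ρ V) : ℕ → V → Fin (ρ.len + 1) → Bool :=
  ((broadcastAlg (Fintype.card V) P).toRoundAlg ρ).extend ω

/-- The coins of a phase are the bits of the silent round of its block 0. Resampling that round
leaves the labels and the earlier failures unchanged. -/
theorem expect_excess_succ_le (hG : G.Connected) {p : ℕ} (hp : p < P) :
    (𝔼 ω : DevSample P ρ V,
      ind (NoFailure P ρ M G s m (DevSample.tape P ρ ω) ((p + 1) * (3 * Fintype.card V + 2))) *
        excess (phaseLabel P ρ M G s m (DevSample.tape P ρ ω) (p + 1))) ≤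
    3 / 4 * 𝔼 ω : DevSample P ρ V,
      ind (NoFailure P ρ M G s m (DevSample.tape P ρ ω) (p * (3 * Fintype.card V + 2))) *
        excess (phaseLabel P ρ M G s m (DevSample.tape P ρ ω) p) := by
  set b := p * (3 * Fintype.card V + 2) with hb
  have hq : b * (ρ.rounds + 1) + ρ.rounds <
      ((broadcastAlg (Fintype.card V) P).toRoundAlg ρ).rounds := by
    have h1 : b + 1 ≤ (P + 1) * (3 * Fintype.card V + 2) := by
      have : (p + 1) * (3 * Fintype.card V + 2) ≤ (P + 1) * (3 * Fintype.card V + 2) :=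
        Nat.mul_le_mul_right _ (by omega)
      rw [add_one_mul p] at this
      omega
    have h2 := Nat.mul_le_mul_right (ρ.rounds + 1) h1
    have h3 : ((broadcastAlg (Fintype.card V) P).toRoundAlg ρ).rounds =
      (P + 1) * (3 * Fintype.card V + 2) * (ρ.rounds + 1) := rfl
    rw [h3]
    rw [add_one_mul b] at h2
    omega
  refine (Finset.expect_le_expect fun ω _ =>
    excess_succ_le P ρ M G s m (DevSample.tape P ρ ω) hp).trans ?_
  rw [expect_resample ⟨_, hq⟩, Finset.mul_expect]
  refine Finset.expect_le_expect fun ω _ => ?_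
  have hconf : ∀ (β : V → Fin (ρ.len + 1) → Bool) (i : ℕ), i ≤ b * (ρ.rounds + 1) + ρ.rounds →
      (broadcastAlg (Fintype.card V) P).conf ρ M G s m
        (DevSample.tape P ρ (Function.update ω ⟨_, hq⟩ β)) i =
      (broadcastAlg (Fintype.card V) P).conf ρ M G s m (DevSample.tape P ρ ω) i :=
    fun β i hi => RoundAlg.exec_update _ M G s m ω ⟨_, hq⟩ β i hi
  have hlab : ∀ β : V → Fin (ρ.len + 1) → Bool,
      phaseLabel P ρ M G s m (DevSample.tape P ρ (Function.update ω ⟨_, hq⟩ β)) p =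
      phaseLabel P ρ M G s m (DevSample.tape P ρ ω) p := by
    intro β
    funext v
    simp only [phaseLabel, devState, BlockAlg.state]
    rw [hconf β _ (by rw [← hb]; omega)]
  have hfail : ∀ β : V → Fin (ρ.len + 1) → Bool,
      NoFailure P ρ M G s m (DevSample.tape P ρ (Function.update ω ⟨_, hq⟩ β)) b ↔
      NoFailure P ρ M G s m (DevSample.tape P ρ ω) b := by
    intro β
    refine forall_congr' fun i => forall_congr' fun hi => forall_congr' fun v => ?_
    have hle : i * (ρ.rounds + 1) ≤ b * (ρ.rounds + 1) := Nat.mul_le_mul_right _ hi.le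
    simp only [DevFails, BlockAlg.Fails]
    rw [hconf β _ (by omega)]
  have hcoin : ∀ β : V → Fin (ρ.len + 1) → Bool,
      BlockAlg.coin ρ (DevSample.tape P ρ (Function.update ω ⟨_, hq⟩ β)) b = fun v => β v 0 := by
    intro β
    funext v
    simp only [BlockAlg.coin]
    have := RoundAlg.extend_update_self _ ω ⟨_, hq⟩ β
    exact congrFun (congrFun this v) 0
  have hrew : ∀ β : V → Fin (ρ.len + 1) → Bool,
      (ind (NoFailure P ρ M G s m (DevSample.tape P ρ (Function.update ω ⟨_, hq⟩ β)) b) *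
        if 2 ≤ #(roots (phaseLabel P ρ M G s m
          (DevSample.tape P ρ (Function.update ω ⟨_, hq⟩ β)) p)) then
          survivors G (phaseLabel P ρ M G s m
            (DevSample.tape P ρ (Function.update ω ⟨_, hq⟩ β)) p)
            (BlockAlg.coin ρ (DevSample.tape P ρ (Function.update ω ⟨_, hq⟩ β)) b) else 0) =
      ind (NoFailure P ρ M G s m (DevSample.tape P ρ ω) b) *
        if 2 ≤ #(roots (phaseLabel P ρ M G s m (DevSample.tape P ρ ω) p)) then
          survivors G (phaseLabel P ρ M G s m (DevSample.tape P ρ ω) p) (fun v => β v 0) else 0 := by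
    intro β
    rw [hlab β, hfail β, hcoin β]
  refine (Finset.expect_congr rfl fun β _ => hrew β).trans_le ?_
  by_cases h : NoFailure P ρ M G s m (DevSample.tape P ρ ω) b
  · simp only [ind_of h, one_mul]
    unfold excess
    by_cases h2 : 2 ≤ #(roots (phaseLabel P ρ M G s m (DevSample.tape P ρ ω) p))
    · simp only [if_pos h2]
      exact expect_survivors_le G ρ.len (h.good hp.le) hG h2
    · simp only [if_neg h2, mul_zero]
      exact (Finset.expect_const_zero _).le
  · simp only [ind_of_not h, zero_mul, mul_zero]
    exact (Finset.expect_const_zero _).le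

theorem expect_excess_le (hG : G.Connected) {p : ℕ} (hp : p ≤ P) :
    (𝔼 ω : DevSample P ρ V,
      ind (NoFailure P ρ M G s m (DevSample.tape P ρ ω) (p * (3 * Fintype.card V + 2))) *
        excess (phaseLabel P ρ M G s m (DevSample.tape P ρ ω) p)) ≤
      (3 / 4) ^ p * Fintype.card V := by
  induction p with
  | zero =>
    rw [pow_zero, one_mul]
    refine Finset.expect_le Finset.univ_nonempty fun ω _ => ?_
    refine (mul_le_of_le_one_left (excess_nonneg _) (ind_le_one _)).trans ((excess_le _).trans ?_)
    exact_mod_cast Finset.card_le_univ _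
  | succ p ih =>
    refine (expect_excess_succ_le P ρ M G s m hG (by omega)).trans ?_
    rw [pow_succ', mul_assoc]
    exact mul_le_mul_of_nonneg_left (ih (by omega)) (by norm_num)

/-- Union bound for each outcome: without success, either some failure indicator is 1, or at least
two roots are left and the excess is at least 2. -/
theorem le_ind_success (τ : ℕ → V → Fin (ρ.len + 1) → Bool) :
    1 - (∑ b ∈ range ((P + 1) * (3 * Fintype.card V + 2)), ∑ v, ind (DevFails P ρ M G s m τ b v) +
      ind (NoFailure P ρ M G s m τ (P * (3 * Fintype.card V + 2))) *
        excess (phaseLabel P ρ M G s m τ P)) ≤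
    ind (∀ v, (broadcastAlg (Fintype.card V) P).out
      (devState P ρ M G s m τ ((P + 1) * (3 * Fintype.card V + 2)) v) = some m) := by
  have hs0 : 0 ≤ ∑ b ∈ range ((P + 1) * (3 * Fintype.card V + 2)),
      ∑ v, ind (DevFails P ρ M G s m τ b v) :=
    Finset.sum_nonneg fun _ _ => Finset.sum_nonneg fun _ _ => ind_nonneg _
  have he0 := mul_nonneg (ind_nonneg (NoFailure P ρ M G s m τ (P * (3 * Fintype.card V + 2))))
    (excess_nonneg (phaseLabel P ρ M G s m τ P))
  by_cases h : NoFailure P ρ M G s m τ ((P + 1) * (3 * Fintype.card V + 2))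
  · by_cases h2 : 2 ≤ #(roots (phaseLabel P ρ M G s m τ P))
    · refine le_trans ?_ (ind_nonneg _)
      rw [ind_of (h.mono (Nat.mul_le_mul_right _ (by omega))), excess, if_pos h2, one_mul]
      have : (2 : ℝ) ≤ #(roots (phaseLabel P ρ M G s m τ P)) := by exact_mod_cast h2
      linarith
    · rw [ind_of fun v => h.succeeds (by omega) v]
      linarith
  · refine le_trans ?_ (ind_nonneg _)
    unfold NoFailure at h
    push Not at h
    obtain ⟨b, hb, v, hbv⟩ := h
    have h1 : ind (DevFails P ρ M G s m τ b v) ≤ ∑ v, ind (DevFails P ρ M G s m τ b v) :=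
      Finset.single_le_sum (f := fun v => ind (DevFails P ρ M G s m τ b v))
        (fun _ _ => ind_nonneg _) (Finset.mem_univ v)
    have h2 : ∑ v, ind (DevFails P ρ M G s m τ b v) ≤
        ∑ b ∈ range ((P + 1) * (3 * Fintype.card V + 2)),
          ∑ v, ind (DevFails P ρ M G s m τ b v) :=
      Finset.single_le_sum (f := fun b => ∑ v, ind (DevFails P ρ M G s m τ b v))
        (fun _ _ => Finset.sum_nonneg fun _ _ => ind_nonneg _) (Finset.mem_range.2 hb)
    rw [ind_of hbv] at h1
    linarith

theorem le_successProb {κ F : ℝ} {pot : ℕ → ℕ → ℝ} (hρ : ρ.Works M G.maxDegree κ F pot)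
    (hG : G.Connected) :
    1 - (((P + 1) * (3 * Fintype.card V + 2) * Fintype.card V : ℕ) * (κ ^ ρ.rounds * F) +
      (3 / 4) ^ P * Fintype.card V) ≤
    ((broadcastAlg (Fintype.card V) P).toRoundAlg ρ).toProtocol.successProb M G s m := by
  rw [RoundAlg.successProb_toProtocol _ M G s m hρ.len_pos]
  refine le_trans ?_ (Finset.expect_le_expect fun ω _ =>
    le_ind_success P ρ M G s m (DevSample.tape P ρ ω))
  rw [Finset.expect_sub_distrib, Finset.expect_const Finset.univ_nonempty,
    Finset.expect_add_distrib, Finset.expect_sum_comm]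
  refine sub_le_sub_left (add_le_add ?_ (expect_excess_le P ρ M G s m hG le_rfl)) _
  calc _ ≤ ∑ b ∈ range ((P + 1) * (3 * Fintype.card V + 2)), ∑ v : V, κ ^ ρ.rounds * F := by
        refine Finset.sum_le_sum fun b hb => ?_
        rw [Finset.expect_sum_comm]
        exact Finset.sum_le_sum fun v _ => BlockAlg.expect_fails_le _ ρ M G s m hρ
          (Finset.mem_range.1 hb) v
    _ = _ := by
        simp only [Finset.sum_const, Finset.card_range, Finset.card_univ, nsmul_eq_mul]
        push_cast
        ring

end Roots

/-! ### What a receiver hears -/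

section Hear

variable {V : Type*} [Fintype V] [DecidableEq V] (ρ : Relay) (M : Model) (G : SimpleGraph V)
  [DecidableRel G.Adj] (role : V → Role) (lev : V → ℕ) (β : V → Fin (ρ.len + 1) → Bool) (v : V)

theorem card_filterMap {α γ : Type*} (f : α → Option γ) (t : Multiset α) :
    (t.filterMap f).card = (t.filter fun a => (f a).isSome).card := by
  induction t using Multiset.induction with
  | empty => simp
  | cons a t ih =>
    cases h : f a with
    | none => rw [Multiset.filterMap_cons_none _ _ h, ih, Multiset.filter_cons_of_neg _ (by simp [h])]
    | some b =>
      rw [Multiset.filterMap_cons_some _ _ _ h, Multiset.card_cons, ih,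
        Multiset.filter_cons_of_pos _ (by simp [h]), Multiset.card_cons]

theorem card_incoming (j : ℕ) :
    (incoming G (fun w => ρ.act (role w) (lev w) (β w) j) v).card =
      #{w ∈ senders G role v | ρ.slot (β w) = j} := by
  classical
  rw [incoming, card_filterMap]
  have : {w ∈ senders G role v | ρ.slot (β w) = j} =
      {w ∈ G.neighborFinset v | (ρ.act (role w) (lev w) (β w) j).sent.isSome} := by
    ext w
    simp only [Finset.mem_filter, mem_senders, SimpleGraph.mem_neighborFinset, and_assoc]
    refine and_congr_right fun _ => ?_
    cases role w with
    | send x => by_cases hj : ρ.slot (β w) = j <;> simp [Role.IsSend, Relay.act, hj, Action.sent]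
    | recv =>
      simp only [Role.IsSend, Relay.act]
      split_ifs <;> simp [Action.sent]
    | idle => simp [Role.IsSend, Relay.act, Action.sent]
  rw [this]
  rfl

theorem hears_of_listens {j : ℕ} (hv : role v = .recv) (hj : j < ρ.len)
    (hl : ρ.listens (lev v) j = true) :
    ρ.hears M G role lev β v j =
      some (hear M (incoming G (fun w => ρ.act (role w) (lev w) (β w) j) v)) := by
  simp [Relay.hears, hj, feedback, hv, Relay.act, hl]

theorem received_ne_none {len : ℕ} {fb : ℕ → Option Signal} {j : ℕ} (hj : j < len) {sig : Signal}
    (h : fb j = some sig) (hs : sig.heard ≠ none) : received len fb ≠ none := by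
  unfold received
  intro hn
  rw [List.findSome?_eq_none_iff] at hn
  have := hn j (List.mem_range.2 hj)
  rw [h] at this
  exact hs this

theorem heard_hear_of_card_eq_one {M : Model} {inc : Multiset Msg} (h : inc.card = 1) :
    (hear M inc).heard ≠ none := by
  have hs := Multiset.card_eq_one.1 h
  cases M with
  | LOCAL =>
    obtain ⟨x, rfl⟩ := hs
    simp [hear, Signal.heard]
  | CD => simp only [hear, dif_pos hs, Signal.heard]; simp
  | NoCD => simp only [hear, dif_pos hs, Signal.heard]; simp

theorem hear_CD_of_card_eq_zero {inc : Multiset Msg} (h : inc.card = 0) :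
    hear .CD inc = .silence := by
  have h0 := Multiset.card_eq_zero.1 h
  have hs : ¬ ∃ msg, inc = {msg} := fun hs => by
    rw [← Multiset.card_eq_one] at hs; omega
  simp only [hear]
  rw [dif_neg hs, if_pos h0]

theorem hear_CD_of_two_le_card {inc : Multiset Msg} (h : 2 ≤ inc.card) :
    hear .CD inc = .noise := by
  have h0 : inc ≠ 0 := fun h0 => by rw [h0] at h; simp at h
  have hs : ¬ ∃ msg, inc = {msg} := fun hs => by
    rw [← Multiset.card_eq_one] at hs; omega
  simp only [hear]
  rw [dif_neg hs, if_neg h0]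

end Hear

/-! ### The relay of the `LOCAL` model -/

/-- All senders send in a single slot. -/
def localRelay : Relay where
  len := 1
  rounds := 1
  slot _ := 0
  listens _ _ := true
  level l _ := l

/-- A single slot always delivers, whence the factor 0. -/
theorem localRelay_works (Δ : ℕ) : localRelay.Works .LOCAL Δ 0 1 (fun _ _ => 1) where
  len_pos := Nat.one_pos
  nonneg := le_rfl
  bound_nonneg := zero_le_one
  one_le _ _ := le_rfl
  start _ _ _ := le_rfl
  round {V} _ _ G _ role lev v hv hpos _ := by
    rw [zero_mul]
    refine le_of_eq (Finset.expect_eq_zero fun β _ => ?_)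
    rw [ind_of_not, zero_mul]
    refine received_ne_none (j := 0) Nat.one_pos
      (hears_of_listens localRelay .LOCAL G role lev β v hv Nat.one_pos rfl) ?_
    have hcard := card_incoming localRelay G role lev β v 0
    have : {w ∈ senders G role v | localRelay.slot (β w) = 0} = senders G role v :=
      Finset.filter_true_of_mem fun _ _ => rfl
    rw [this] at hcard
    simp only [hear, Signal.heard]
    intro hn
    rw [List.head?_eq_none_iff, Multiset.toList_eq_nil] at hn
    rw [hn, Multiset.card_zero] at hcard
    omega

/-! ### Sending in random slots -/

open Classical in
/-- The index of the first bit that is `false`. -/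
noncomputable def firstFalse {len : ℕ} (β : Fin (len + 1) → Bool) : ℕ :=
  Nat.find (p := fun j => ∀ h : j < len + 1, β ⟨j, h⟩ = false)
    ⟨len + 1, fun h => absurd h (lt_irrefl _)⟩

theorem firstFalse_eq_iff {len : ℕ} (β : Fin (len + 1) → Bool) {j : ℕ} (hj : j < len + 1) :
    firstFalse β = j ↔ ∀ i ∈ Finset.Iic (⟨j, hj⟩ : Fin (len + 1)), β i = decide (i.val < j) := by
  unfold firstFalse
  rw [Nat.find_eq_iff]
  constructor
  · rintro ⟨h1, h2⟩ i hi
    rw [Finset.mem_Iic, Fin.le_def] at hi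
    rcases Nat.lt_or_ge i.val j with h | h
    · have := h2 i.val h
      push Not at this
      obtain ⟨_, hb⟩ := this
      simpa [h] using hb
    · have : i = ⟨j, hj⟩ := Fin.ext (le_antisymm hi h)
      subst this
      simpa using h1 hj
  · intro h
    refine ⟨fun hj' => ?_, fun k hk hall => ?_⟩
    · simpa using h ⟨j, hj⟩ (by simp)
    · have h1 := hall (by omega)
      have h2 := h ⟨k, by omega⟩ (by rw [Finset.mem_Iic, Fin.le_def]; exact hk.le)
      rw [h1] at h2
      simp [hk] at h2

/-- The event prescribes `j + 1` bits: `j` times `true`, then `false`. Values from `len` on mean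
that the sender skips the round. -/
theorem expect_firstFalse {len j : ℕ} (hj : j < len) :
    (𝔼 β : Fin (len + 1) → Bool, ind (firstFalse β = j)) = (1 / 2) ^ (j + 1) := by
  have hj' : j < len + 1 := by omega
  simp only [firstFalse_eq_iff _ hj']
  rw [expect_ind_forall (Finset.Iic (⟨j, hj'⟩ : Fin (len + 1)))
    (fun i a => a = decide (i.val < j))]
  have : ∀ b : Bool, (𝔼 a : Bool, ind (a = b)) = 1 / 2 := by
    intro b
    rw [Finset.expect_eq_sum_div_card]
    cases b <;> simp [ind]
  simp only [this, Finset.prod_const, Fin.card_Iic]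

/-- Here `k * p ≥ 1/2`, and Bernoulli's inequality gives `(1 - p) ^ 2 ^ j ≥ 1/2`; squaring it covers
the exponent `k - 1 < 2 ^ (j + 1)`. -/
theorem one_eighth_le_single {k j : ℕ} {p : ℝ} (hp : p = (1 / 2) ^ (j + 1)) (h1 : 2 ^ j ≤ k)
    (h2 : k < 2 ^ (j + 1)) : 1 / 8 ≤ k * (p * (1 - p) ^ (k - 1)) := by
  have hp0 : 0 < p := by rw [hp]; positivity
  have hp1 : p ≤ 1 / 2 := by
    rw [hp, pow_succ]
    have : ((1 : ℝ) / 2) ^ j ≤ 1 := pow_le_one₀ (by norm_num) (by norm_num)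
    linarith
  have hq0 : 0 ≤ 1 - p := by linarith
  have hkp : 1 / 2 ≤ k * p := by
    have : (2 : ℝ) ^ j ≤ k := by exact_mod_cast h1
    calc (1 : ℝ) / 2 = 2 ^ j * p := by
          rw [hp, pow_succ, ← mul_assoc, ← mul_pow]; norm_num
      _ ≤ k * p := by gcongr
  have hhalf : 1 / 2 ≤ (1 - p) ^ 2 ^ j := by
    have := one_add_mul_le_pow (a := -p) (by linarith) (2 ^ j)
    have h3 : ((2 ^ j : ℕ) : ℝ) * p = 1 / 2 := by
      rw [hp, pow_succ]; push_cast; rw [← mul_assoc, ← mul_pow]; norm_num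
    rw [mul_neg, h3] at this
    rw [sub_eq_add_neg]
    linarith
  have hpow : 1 / 4 ≤ (1 - p) ^ (k - 1) := by
    calc (1 : ℝ) / 4 ≤ ((1 - p) ^ 2 ^ j) ^ 2 := by nlinarith
      _ = (1 - p) ^ 2 ^ (j + 1) := by rw [← pow_mul, ← pow_succ]
      _ ≤ (1 - p) ^ (k - 1) := pow_le_pow_of_le_one hq0 (by linarith) (by omega)
  rw [← mul_assoc]
  nlinarith

/-- Since `k * p ≥ 1`, the left side is at most `exp (-1) < 3/8`. -/
theorem none_le_three_eighths {k j : ℕ} {p : ℝ} (hp : p = (1 / 2) ^ (j + 1))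
    (h : 2 ^ (j + 1) ≤ k) : (1 - p) ^ k ≤ 3 / 8 := by
  have hp0 : 0 < p := by rw [hp]; positivity
  have hp1 : p ≤ 1 := by rw [hp]; exact pow_le_one₀ (by norm_num) (by norm_num)
  have hkp : 1 ≤ k * p := by
    have : (2 : ℝ) ^ (j + 1) ≤ k := by exact_mod_cast h
    calc (1 : ℝ) = 2 ^ (j + 1) * p := by rw [hp, ← mul_pow]; norm_num
      _ ≤ k * p := by gcongr
  calc (1 - p) ^ k ≤ Real.exp (-p) ^ k :=
        pow_le_pow_left₀ (by linarith) (Real.one_sub_le_exp_neg p) k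
    _ = Real.exp (-(k * p)) := by rw [← Real.exp_nat_mul]; congr 1; ring
    _ ≤ Real.exp (-1) := Real.exp_le_exp.2 (by linarith)
    _ ≤ 3 / 8 := by
        rw [Real.exp_neg, inv_le_comm₀ (Real.exp_pos _) (by norm_num)]
        have := Real.exp_one_gt_d9
        norm_num
        linarith

/-- With `k = i + 1` the sum is `(1 - p) ^ i * (1 + i * p)`, by Bernoulli at least `1 - (i * p) ^
2`, and `i * p ≤ 1/2`. -/
theorem three_quarters_le_at_most_one {k j : ℕ} {p : ℝ} (hp : p = (1 / 2) ^ (j + 1)) (hk : 0 < k)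
    (h : k ≤ 2 ^ j) : 3 / 4 ≤ (1 - p) ^ k + k * (p * (1 - p) ^ (k - 1)) := by
  have hp0 : 0 < p := by rw [hp]; positivity
  have hp1 : p ≤ 1 := by rw [hp]; exact pow_le_one₀ (by norm_num) (by norm_num)
  obtain ⟨i, rfl⟩ : ∃ i, k = i + 1 := ⟨k - 1, by omega⟩
  have hip : i * p ≤ 1 / 2 := by
    have : ((i + 1 : ℕ) : ℝ) ≤ 2 ^ j := by exact_mod_cast h
    push_cast at this
    calc i * p ≤ 2 ^ j * p := by gcongr; linarith
      _ = 1 / 2 := by rw [hp, pow_succ, ← mul_assoc, ← mul_pow]; norm_num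
  have hi0 : 0 ≤ i * p := by positivity
  have hb := one_add_mul_le_pow (a := -p) (by linarith) i
  rw [← sub_eq_add_neg, mul_neg, ← sub_eq_add_neg] at hb
  have : (1 - p) ^ (i + 1) + (i + 1 : ℕ) * (p * (1 - p) ^ (i + 1 - 1)) =
      (1 - p) ^ i * (1 + i * p) := by
    rw [Nat.add_sub_cancel, pow_succ]; push_cast; ring
  rw [this]
  nlinarith [mul_le_mul_of_nonneg_right hb (show 0 ≤ 1 + (i : ℝ) * p by linarith)]

/-! ### The relay of the `No-CD` model -/

/-- Senders send in random slots of `⌊log₂ Δ⌋ + 1` slots, and receivers always listen. -/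
noncomputable def decayRelay (Δ R : ℕ) : Relay where
  len := Nat.log 2 Δ + 1
  rounds := R
  slot β := firstFalse β
  listens _ _ := true
  level l _ := l

/-- Slot `⌊log₂ k⌋` carries exactly one message with probability at least 1/8. The factor 7/8 is
weakened to 63/64 to share the round count with the `CD` relay. -/
theorem decayRelay_works (Δ R : ℕ) :
    (decayRelay Δ R).Works .NoCD Δ (63 / 64) 1 (fun _ _ => 1) where
  len_pos := Nat.succ_pos _
  nonneg := by norm_num
  bound_nonneg := zero_le_one
  one_le _ _ := le_rfl
  start _ _ _ := le_rfl
  round {V} _ _ G _ role lev v hv hpos hle := by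
    set k := #(senders G role v) with hk
    set j := Nat.log 2 k with hj
    have hjlen : j < (decayRelay Δ R).len := Nat.lt_succ_of_le (Nat.log_mono_right hle)
    have h1 := expect_card_eq_one (ι := V) (senders G role v)
      (fun β : Fin ((decayRelay Δ R).len + 1) → Bool => firstFalse β = j) _
      (expect_firstFalse hjlen)
    have h2 := one_eighth_le_single (k := k) (j := j) rfl (Nat.pow_log_le_self 2 (by omega))
      (Nat.lt_pow_succ_log_self (by norm_num) k)
    simp only [mul_one]
    calc _ ≤ 𝔼 β : V → Fin ((decayRelay Δ R).len + 1) → Bool,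
            ind (¬ #{w ∈ senders G role v | firstFalse (β w) = j} = 1) := by
          refine Finset.expect_le_expect fun β _ => ind_mono fun hn hone => ?_
          refine received_ne_none hjlen
            (hears_of_listens (decayRelay Δ R) .NoCD G role lev β v hv hjlen rfl) ?_ hn
          exact heard_hear_of_card_eq_one
            ((card_incoming (decayRelay Δ R) G role lev β v j).trans hone)
      _ ≤ 63 / 64 := by
          rw [expect_ind_not (fun β : V → Fin ((decayRelay Δ R).len + 1) → Bool =>
            #{w ∈ senders G role v | firstFalse (β w) = j} = 1), h1]
          linarith

/-! ### The relay of the `CD` model -/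

/-- Senders send in random slots of `⌊log₂ Δ⌋ + 1` slots. A receiver listens in one slot only: the
next one in the next round if it hears noise, and the previous one if it hears silence. -/
noncomputable def walkRelay (Δ R : ℕ) : Relay where
  len := Nat.log 2 Δ + 1
  rounds := R
  slot β := firstFalse β
  listens l j := decide (j = min l (Nat.log 2 Δ))
  level l fb :=
    match fb (min l (Nat.log 2 Δ)) with
    | some .noise => min (min l (Nat.log 2 Δ) + 1) (Nat.log 2 Δ)
    | _ => min l (Nat.log 2 Δ) - 1

/-- The potential of the random walk of a receiver with `k` sending neighbors. -/
noncomputable def walkPot (Δ k l : ℕ) : ℝ :=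
  -- Two truncated differences add up to the distance between the slot listened to and `⌊log₂ k⌋`.
  (9 / 8) ^ ((min l (Nat.log 2 Δ) - Nat.log 2 k) + (Nat.log 2 k - min l (Nat.log 2 Δ)))

/-- The walk drifts towards `⌊log₂ k⌋`: below it silence has probability at most 3/8, above it noise
has probability at most 1/4, and at it a message arrives with probability at least 1/8. A wrong step
costs at most the factor 9/8, a right one gains 8/9. -/
theorem walkRelay_works (Δ R : ℕ) :
    (walkRelay Δ R).Works .CD Δ (63 / 64) Δ (walkPot Δ) where
  len_pos := Nat.succ_pos _
  nonneg := by norm_num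
  bound_nonneg := Nat.cast_nonneg _
  one_le _ _ := one_le_pow₀ (by norm_num)
  start k hk hkΔ := by
    simp only [walkPot, Nat.zero_min, Nat.zero_sub, zero_add, Nat.sub_zero]
    calc ((9 : ℝ) / 8) ^ Nat.log 2 k ≤ 2 ^ Nat.log 2 k :=
          pow_le_pow_left₀ (by norm_num) (by norm_num) _
      _ ≤ k := by exact_mod_cast Nat.pow_log_le_self 2 (by omega)
      _ ≤ Δ := by exact_mod_cast hkΔ
  round {V} _ _ G _ role lev v hv hpos hle := by
    set k := #(senders G role v) with hk
    set l := min (lev v) (Nat.log 2 Δ) with hl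
    have hllen : l < (walkRelay Δ R).len := Nat.lt_succ_of_le (min_le_right _ _)
    have hlis : (walkRelay Δ R).listens (lev v) l = true := by
      simp [walkRelay, hl]
    set p : ℝ := (1 / 2) ^ (l + 1) with hp
    have h0 := expect_card_eq_zero (ι := V) (senders G role v)
      (fun β : Fin ((walkRelay Δ R).len + 1) → Bool => firstFalse β = l) p
      (expect_firstFalse hllen)
    have h1 := expect_card_eq_one (ι := V) (senders G role v)
      (fun β : Fin ((walkRelay Δ R).len + 1) → Bool => firstFalse β = l) p
      (expect_firstFalse hllen)
    set A := walkPot Δ k (l - 1) with hA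
    set B := walkPot Δ k (min (l + 1) (Nat.log 2 Δ)) with hB
    set c := walkPot Δ k (lev v) with hc
    have hA0 : 0 ≤ A := by rw [hA, walkPot]; positivity
    have hB0 : 0 ≤ B := by rw [hB, walkPot]; positivity
    have hc0 : 0 ≤ c := by rw [hc, walkPot]; positivity
    -- Silence leads to potential `A`, noise to potential `B`, and a message to 0.
    have hbound : ∀ β : V → Fin ((walkRelay Δ R).len + 1) → Bool,
        ind (received (walkRelay Δ R).len ((walkRelay Δ R).hears .CD G role lev β v) = none) *
          walkPot Δ k ((walkRelay Δ R).level (lev v)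
            ((walkRelay Δ R).hears .CD G role lev β v)) ≤
        ind (#{w ∈ senders G role v | firstFalse (β w) = l} = 0) * A +
          (1 - ind (#{w ∈ senders G role v | firstFalse (β w) = l} = 0) -
            ind (#{w ∈ senders G role v | firstFalse (β w) = l} = 1)) * B := by
      intro β
      have hcard : _ = #{w ∈ senders G role v | firstFalse (β w) = l} :=
        card_incoming (walkRelay Δ R) G role lev β v l
      have hhear := hears_of_listens (walkRelay Δ R) .CD G role lev β v hv hllen hlis
      rcases Nat.lt_trichotomy #{w ∈ senders G role v | firstFalse (β w) = l} 1 with hN | hN | hN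
      · have hN0 : #{w ∈ senders G role v | firstFalse (β w) = l} = 0 := by omega
        rw [hear_CD_of_card_eq_zero (hcard.trans hN0)] at hhear
        have hlev : (walkRelay Δ R).level (lev v) ((walkRelay Δ R).hears .CD G role lev β v) =
            l - 1 := by
          simp only [walkRelay] at hhear ⊢
          rw [hhear]
        rw [ind_of hN0, ind_of_not (by omega : ¬ _ = 1), hlev]
        have := mul_le_of_le_one_left hA0 (ind_le_one
          (received (walkRelay Δ R).len ((walkRelay Δ R).hears .CD G role lev β v) = none))
        linarith
      · rw [ind_of_not (received_ne_none hllen hhear (heard_hear_of_card_eq_one (hcard.trans hN))),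
          ind_of hN, ind_of_not (by omega : ¬ _ = 0)]
        simp
      · rw [hear_CD_of_two_le_card (by rw [hcard]; omega)] at hhear
        have hlev : (walkRelay Δ R).level (lev v) ((walkRelay Δ R).hears .CD G role lev β v) =
            min (l + 1) (Nat.log 2 Δ) := by
          simp only [walkRelay] at hhear ⊢
          rw [hhear]
        rw [ind_of_not (by omega : ¬ _ = 0), ind_of_not (by omega : ¬ _ = 1), hlev]
        have := mul_le_of_le_one_left hB0 (ind_le_one
          (received (walkRelay Δ R).len ((walkRelay Δ R).hears .CD G role lev β v) = none))
        linarith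
    refine (Finset.expect_le_expect fun β _ => hbound β).trans ?_
    rw [Finset.expect_add_distrib, ← Finset.expect_mul, ← Finset.expect_mul,
      Finset.expect_sub_distrib, Finset.expect_sub_distrib,
      Finset.expect_const Finset.univ_nonempty, h0, h1]
    set P0 := (1 - p) ^ k with hP0
    set P1 := k * (p * (1 - p) ^ (k - 1)) with hP1
    have hp1 : p ≤ 1 := pow_le_one₀ (by norm_num) (by norm_num)
    have hp0 : 0 ≤ p := by positivity
    have hP0' : 0 ≤ P0 := pow_nonneg (by linarith) _
    have hP1' : 0 ≤ P1 := by
      have : 0 ≤ (1 - p) ^ (k - 1) := pow_nonneg (by linarith) _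
      positivity
    have hP2' : 0 ≤ 1 - P0 - P1 := by
      have : 0 ≤ 𝔼 β : V → Fin ((walkRelay Δ R).len + 1) → Bool,
          (1 - ind (#{w ∈ senders G role v | firstFalse (β w) = l} = 0) -
            ind (#{w ∈ senders G role v | firstFalse (β w) = l} = 1)) := by
        refine Finset.expect_nonneg fun β _ => ?_
        by_cases hN : #{w ∈ senders G role v | firstFalse (β w) = l} = 0
        · rw [ind_of hN, ind_of_not (by omega : ¬ _ = 1)]; norm_num
        · rw [ind_of_not hN]
          linarith [ind_le_one (#{w ∈ senders G role v | firstFalse (β w) = l} = 1)]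
      rwa [Finset.expect_sub_distrib, Finset.expect_sub_distrib,
        Finset.expect_const Finset.univ_nonempty, h0, h1] at this
    have hlogk : Nat.log 2 k ≤ Nat.log 2 Δ := Nat.log_mono_right hle
    have hlΔ : l ≤ Nat.log 2 Δ := min_le_right _ _
    have hcl : c = (9 / 8) ^ ((l - Nat.log 2 k) + (Nat.log 2 k - l)) := rfl
    have hAl : A = (9 / 8) ^ ((l - 1 - Nat.log 2 k) + (Nat.log 2 k - (l - 1))) := by
      rw [hA, walkPot, min_eq_left (by omega)]
    have hBl : B = (9 / 8) ^ ((min (l + 1) (Nat.log 2 Δ) - Nat.log 2 k) +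
        (Nat.log 2 k - min (l + 1) (Nat.log 2 Δ))) := by
      rw [hB, walkPot, min_eq_left (min_le_right _ _)]
    have hle_of : ∀ a b : ℕ, a ≤ b + 1 → ((9 : ℝ) / 8) ^ a ≤ 9 / 8 * (9 / 8) ^ b := by
      intro a b hab
      rw [← pow_succ']
      exact pow_le_pow_right₀ (by norm_num) hab
    have hAc : A ≤ 9 / 8 * c := by
      rw [hAl, hcl]; exact hle_of _ _ (by omega)
    have hBc : B ≤ 9 / 8 * c := by
      rw [hBl, hcl]; exact hle_of _ _ (by omega)
    rcases Nat.lt_trichotomy l (Nat.log 2 k) with hlk | hlk | hlk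
    -- Too low: the factor is at most `3/8 * 9/8 + 5/8 * 8/9 < 63/64`.
    · have hBc' : 9 / 8 * B = c := by
        rw [hBl, hcl, ← pow_succ']; congr 1; omega
      have hsmall : P0 ≤ 3 / 8 := none_le_three_eighths hp
        ((Nat.pow_le_pow_right (by norm_num) hlk).trans (Nat.pow_log_le_self 2 (by omega)))
      have hB' : B = 8 / 9 * c := by linarith
      have e1 : P0 * A ≤ P0 * (9 / 8 * c) := mul_le_mul_of_nonneg_left hAc hP0'
      have e2 : (1 - P0 - P1) * B ≤ (1 - P0) * (8 / 9 * c) := by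
        rw [hB']
        exact mul_le_mul_of_nonneg_right (by linarith) (by positivity)
      have e3 : P0 * c ≤ 3 / 8 * c := mul_le_mul_of_nonneg_right hsmall hc0
      linarith
    -- At the target every move is a wrong one: `7/8 * 9/8 = 63/64` is the case that determines `κ`.
    · have hbig : 1 / 8 ≤ P1 := one_eighth_le_single hp
        (by rw [hlk]; exact Nat.pow_log_le_self 2 (by omega))
        (by rw [hlk]; exact Nat.lt_pow_succ_log_self (by norm_num) k)
      have e1 : P0 * A ≤ P0 * (9 / 8 * c) := mul_le_mul_of_nonneg_left hAc hP0'
      have e2 : (1 - P0 - P1) * B ≤ (1 - P0 - P1) * (9 / 8 * c) :=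
        mul_le_mul_of_nonneg_left hBc hP2'
      have e3 : 1 / 8 * c ≤ P1 * c := mul_le_mul_of_nonneg_right hbig hc0
      linarith
    -- Too high: the factor is at most `3/4 * 8/9 + 1/4 * 9/8 = 91/96`.
    · have hAc' : 9 / 8 * A = c := by
        rw [hAl, hcl, ← pow_succ']; congr 1; omega
      have hbig : 3 / 4 ≤ P0 + P1 := three_quarters_le_at_most_one hp hpos
        ((Nat.lt_pow_succ_log_self (by norm_num) k).le.trans
          (Nat.pow_le_pow_right (by norm_num) hlk))
      have hA' : A = 8 / 9 * c := by linarith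
      have e2 : (1 - P0 - P1) * B ≤ (1 - P0 - P1) * (9 / 8 * c) :=
        mul_le_mul_of_nonneg_left hBc hP2'
      have e1 : P0 * A ≤ (1 - (1 - P0 - P1)) * (8 / 9 * c) := by
        rw [hA']
        exact mul_le_mul_of_nonneg_right (by linarith) (by positivity)
      have e3 : (1 - P0 - P1) * c ≤ 1 / 4 * c := mul_le_mul_of_nonneg_right (by linarith) hc0
      linarith

/-! ### The number of slots in which a device is active -/

open Classical in
theorem card_act_le (ρ : Relay) {e : ℕ} (he : 1 ≤ e)
    (hl : ∀ l, #{j ∈ range ρ.len | ρ.listens l j = true} ≤ e) (r : Role) (l : ℕ)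
    (β : Fin (ρ.len + 1) → Bool) : #{j ∈ range ρ.len | ρ.act r l β j ≠ Action.idle} ≤ e := by
  cases r with
  | send x =>
    refine (Finset.card_le_one.2 fun i hi j hj => ?_).trans he
    have h : ∀ i ∈ ({j ∈ range ρ.len | ρ.act (.send x) l β j ≠ Action.idle} : Finset ℕ),
        ρ.slot β = i := by
      intro i hi
      have := (Finset.mem_filter.1 hi).2
      by_contra hne
      simp [Relay.act, hne] at this
    rw [← h i hi, h j hj]
  | recv =>
    refine le_trans (Finset.card_le_card fun i hi => ?_) (hl l)
    rw [Finset.mem_filter] at hi ⊢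
    refine ⟨hi.1, ?_⟩
    by_contra hne
    exact hi.2 (by simp [Relay.act, hne])
  | idle => simp [Relay.act]

/-! ### The choice of the parameters -/

/-- The protocol that does nothing. -/
def idleProtocol : Protocol where
  coins := 0
  slots := 0
  State := Unit
  start _ _ := ()
  act _ _ := .idle
  next _ _ _ := ()
  output _ := none

theorem half_pow_log_le {n : ℕ} (hn : 2 ≤ n) (c : ℕ) :
    ((1 : ℝ) / 2) ^ (c * (Nat.log 2 n + 1)) ≤ 1 / (n : ℝ) ^ c := by
  have h : (n : ℝ) ≤ 2 ^ (Nat.log 2 n + 1) := by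
    exact_mod_cast (Nat.lt_pow_succ_log_self (by norm_num) n).le
  have hn0 : (0 : ℝ) < n := by positivity
  rw [one_div, inv_pow, ← one_div, mul_comm, pow_mul]
  exact one_div_le_one_div_of_le (by positivity) (pow_le_pow_left₀ hn0.le h c)

/-- Both `⌊log₂ n⌋` and 1 are at most `log n / log 2`, and `2 / log 2 < 3`. -/
theorem log_add_one_le {n : ℕ} (hn : 2 ≤ n) : ((Nat.log 2 n + 1 : ℕ) : ℝ) ≤ 3 * Real.log n := by
  have h2 := Real.log_two_gt_d9
  have h1 : (Nat.log 2 n : ℝ) * Real.log 2 ≤ Real.log n := by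
    rw [← Real.log_pow]
    refine Real.log_le_log (by positivity) ?_
    exact_mod_cast Nat.pow_log_le_self 2 (by omega)
  have h3 : Real.log 2 ≤ Real.log n := Real.log_le_log (by norm_num) (by exact_mod_cast hn)
  have h4 : (0 : ℝ) ≤ Nat.log 2 n := Nat.cast_nonneg _
  push_cast
  nlinarith

theorem log_add_one_le' {Δ : ℕ} (hΔ : 1 ≤ Δ) :
    ((Nat.log 2 Δ + 1 : ℕ) : ℝ) ≤ 3 * Real.log ((Δ : ℝ) + 1) := by
  have h := log_add_one_le (n := Δ + 1) (by omega)
  push_cast at h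
  have : (Nat.log 2 Δ : ℝ) ≤ Nat.log 2 (Δ + 1) := by
    exact_mod_cast Nat.log_mono_right (Nat.le_succ Δ)
  push_cast
  linarith

theorem three_mul_add_seven_le (c : ℕ) : 3 * c + 7 ≤ 2 ^ (c + 3) := by
  induction c with
  | zero => norm_num
  | succ c ih => rw [show c + 1 + 3 = c + 3 + 1 by ring, pow_succ]; omega

/-- Each of the two terms is at most `n^-(c+1)`, hence at most half of `n^-c`. There are at most `n
^ (c + 8)` pairs of a block and a device, the constant `3 * c + 7` being absorbed by `2 ^ (c + 3) ≤
n ^ (c + 3)`. For the roots, `(3/4) ^ 3 ≤ 1/2` explains the 3 in the number of phases. -/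
theorem failure_le {n c : ℕ} (hn : 2 ≤ n) {δ : ℝ} (hδ : δ ≤ 1 / (n : ℝ) ^ (2 * c + 9)) :
    (((3 * (c + 2) * (Nat.log 2 n + 1) + 1) * (3 * n + 2) * n : ℕ) : ℝ) * δ +
      (3 / 4) ^ (3 * (c + 2) * (Nat.log 2 n + 1)) * n ≤ 1 / (n : ℝ) ^ c := by
  have hn0 : (0 : ℝ) < n := by positivity
  have hn2 : (2 : ℝ) ≤ n := by exact_mod_cast hn
  have hhalf : 1 / (n : ℝ) ^ (c + 1) ≤ 1 / 2 * (1 / (n : ℝ) ^ c) := by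
    rw [pow_succ, one_div, mul_inv, mul_comm, ← one_div (_ ^ c)]
    refine mul_le_mul_of_nonneg_right ?_ (by positivity)
    rw [one_div]
    exact inv_anti₀ (by norm_num) hn2
  have hN : (3 * (c + 2) * (Nat.log 2 n + 1) + 1) * (3 * n + 2) * n ≤ n ^ (c + 8) := by
    have hl : Nat.log 2 n + 1 ≤ n := Nat.log_lt_self 2 (by omega)
    have hc := three_mul_add_seven_le c
    calc (3 * (c + 2) * (Nat.log 2 n + 1) + 1) * (3 * n + 2) * n
        ≤ ((3 * c + 7) * n) * (4 * n) * n := by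
          gcongr
          · nlinarith
          · omega
      _ = (3 * c + 7) * 2 ^ 2 * n ^ 3 := by ring
      _ ≤ 2 ^ (c + 3) * 2 ^ 2 * n ^ 3 := by gcongr
      _ = 2 ^ (c + 5) * n ^ 3 := by ring
      _ ≤ n ^ (c + 5) * n ^ 3 := by gcongr
      _ = n ^ (c + 8) := by ring
  have h1 : (((3 * (c + 2) * (Nat.log 2 n + 1) + 1) * (3 * n + 2) * n : ℕ) : ℝ) * δ ≤
      1 / (n : ℝ) ^ (c + 1) := by
    calc _ ≤ (((3 * (c + 2) * (Nat.log 2 n + 1) + 1) * (3 * n + 2) * n : ℕ) : ℝ) *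
          (1 / (n : ℝ) ^ (2 * c + 9)) := mul_le_mul_of_nonneg_left hδ (Nat.cast_nonneg _)
      _ ≤ (n : ℝ) ^ (c + 8) * (1 / (n : ℝ) ^ (2 * c + 9)) := by
          refine mul_le_mul_of_nonneg_right ?_ (by positivity)
          exact_mod_cast hN
      _ = 1 / (n : ℝ) ^ (c + 1) := by
          rw [show 2 * c + 9 = (c + 8) + (c + 1) by ring, pow_add _ (c + 8), one_div, mul_inv,
            mul_inv_cancel_left₀ (by positivity), one_div]
  have h2 : ((3 : ℝ) / 4) ^ (3 * (c + 2) * (Nat.log 2 n + 1)) * n ≤ 1 / (n : ℝ) ^ (c + 1) := by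
    calc ((3 : ℝ) / 4) ^ (3 * (c + 2) * (Nat.log 2 n + 1)) * n
        = (((3 : ℝ) / 4) ^ 3) ^ ((c + 2) * (Nat.log 2 n + 1)) * n := by
          rw [← pow_mul, mul_assoc]
      _ ≤ ((1 : ℝ) / 2) ^ ((c + 2) * (Nat.log 2 n + 1)) * n := by
          refine mul_le_mul_of_nonneg_right ?_ hn0.le
          exact pow_le_pow_left₀ (by norm_num) (by norm_num) _
      _ ≤ 1 / (n : ℝ) ^ (c + 2) * n := mul_le_mul_of_nonneg_right (half_pow_log_le hn _) hn0.le
      _ = 1 / (n : ℝ) ^ (c + 1) := by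
          rw [pow_succ _ (c + 1)]
          field_simp
  linarith

open Classical in
/-- Broadcast from relays that fail with probability at most `1 / n ^ c`. -/
theorem broadcastWHP_of_relays (M : Model) (T E : ℕ → ℕ → ℝ) (hT : ∀ Δ, 0 ≤ T 1 Δ)
    (hE : ∀ Δ, 0 ≤ E 1 Δ)
    (h : ∀ c : ℕ, ∃ C : ℝ, 0 < C ∧ ∃ ρ : ℕ → ℕ → Relay, ∀ n Δ, 2 ≤ n → 1 ≤ Δ → Δ < n →
      (∃ κ F pot, (ρ n Δ).Works M Δ κ F pot ∧ κ ^ (ρ n Δ).rounds * F ≤ 1 / (n : ℝ) ^ c) ∧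
      (n * (Nat.log 2 n + 1) * (((ρ n Δ).rounds + 1) * (ρ n Δ).len) : ℕ) ≤ C * T n Δ ∧
      ∃ e : ℕ, (∀ r l β, #{j ∈ range (ρ n Δ).len | (ρ n Δ).act r l β j ≠ Action.idle} ≤ e) ∧
        ((Nat.log 2 n + 1) * ((ρ n Δ).rounds * e) : ℕ) ≤ C * E n Δ) :
    BroadcastWHP M T E := by
  intro c
  obtain ⟨C, hC, ρ, hρ⟩ := h (2 * c + 9)
  obtain ⟨A, hA⟩ : ∃ A : ℕ → ℕ → Protocol, ∀ n Δ, A n Δ = if n ≤ 1 then idleProtocol else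
    ((broadcastAlg n (3 * (c + 2) * (Nat.log 2 n + 1))).toRoundAlg (ρ n Δ)).toProtocol :=
    ⟨_, fun _ _ => rfl⟩
  -- The factor 28 serves both bounds: `3 * n + 2 ≤ 28 * n` blocks per phase, and 7 active ones. The
  -- factor `3 * c + 7` comes from the number `P + 1` of phases.
  refine ⟨28 * (3 * c + 7) * C, by positivity, A, ?_⟩
  intro V _ _ G _ hG s m n Δ hn hΔ
  rcases Nat.lt_or_ge 1 n with hn1 | hn1
  · rw [(hA n Δ).trans (if_neg (not_le.2 hn1))]
    have : Nontrivial V := Fintype.one_lt_card_iff_nontrivial.1 (hn ▸ hn1)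
    have hΔ1 : 1 ≤ Δ := by
      rw [hΔ]
      exact (hG.preconnected.minDegree_pos_of_nontrivial).trans_le G.minDegree_le_maxDegree
    have hΔn : Δ < n := by
      rw [hΔ, hn]
      exact G.maxDegree_lt_card_verts
    obtain ⟨⟨κ, F, pot, hW, hδ⟩, htime, e, he, henergy⟩ := hρ n Δ hn1 hΔ1 hΔn
    set l := Nat.log 2 n + 1 with hl
    set P := 3 * (c + 2) * l with hP
    have hP1 : P + 1 ≤ (3 * c + 7) * l := by
      have : 1 ≤ l := by omega
      rw [hP]; nlinarith
    refine ⟨?_, fun r v => ?_, ?_⟩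
    · have h1 : ((broadcastAlg n P).toRoundAlg (ρ n Δ)).toProtocol.slots ≤
          28 * (3 * c + 7) * (n * l * (((ρ n Δ).rounds + 1) * (ρ n Δ).len)) := by
        change (P + 1) * (3 * n + 2) * ((ρ n Δ).rounds + 1) * (ρ n Δ).len ≤ _
        calc (P + 1) * (3 * n + 2) * ((ρ n Δ).rounds + 1) * (ρ n Δ).len
            ≤ ((3 * c + 7) * l) * (28 * n) * ((ρ n Δ).rounds + 1) * (ρ n Δ).len := by
              gcongr
              omega
          _ = _ := by ring
      have h2 : ((((broadcastAlg n P).toRoundAlg (ρ n Δ)).toProtocol.slots : ℕ) : ℝ) ≤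
          28 * (3 * c + 7) * ((n * l * (((ρ n Δ).rounds + 1) * (ρ n Δ).len) : ℕ) : ℝ) := by
        exact_mod_cast h1
      refine h2.trans ?_
      rw [mul_assoc _ C]
      exact mul_le_mul_of_nonneg_left htime (by positivity)
    · have h1 : ((broadcastAlg n P).toRoundAlg (ρ n Δ)).toProtocol.energy M G s m r v ≤
          28 * (3 * c + 7) * (l * ((ρ n Δ).rounds * e)) := by
        subst hn
        refine ((broadcastAlg _ P).energy_le (ρ _ Δ) M G s m hW.len_pos e he _ v
          (fun τ => card_active_le P (ρ _ Δ) M G s m τ v) r).trans ?_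
        calc (P + 1) * 7 * ((ρ (Fintype.card V) Δ).rounds * e)
            ≤ ((3 * c + 7) * l) * 28 * ((ρ (Fintype.card V) Δ).rounds * e) := by
              gcongr
              norm_num
          _ = _ := by ring
      have h2 : ((((broadcastAlg n P).toRoundAlg (ρ n Δ)).toProtocol.energy M G s m r v : ℕ) : ℝ) ≤
          28 * (3 * c + 7) * ((l * ((ρ n Δ).rounds * e) : ℕ) : ℝ) := by
        exact_mod_cast h1
      refine h2.trans ?_
      rw [mul_assoc _ C]
      exact mul_le_mul_of_nonneg_left henergy (by positivity)
    · have hf := failure_le hn1 hδ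
      subst hn hΔ
      refine le_trans ?_ (le_successProb P (ρ _ _) M G s m hW hG)
      linarith
  -- For `n = 1` the logarithm makes the bounds vanish in the intended cases, so no slot may be
  -- used; the required probability is 0.
  · have : Nonempty V := hG.nonempty
    have hn' : n = 1 := le_antisymm hn1 (hn ▸ Fintype.card_pos)
    subst hn'
    rw [(hA 1 Δ).trans (if_pos le_rfl)]
    refine ⟨?_, fun r v => ?_, ?_⟩
    · have := hT Δ
      simp only [idleProtocol, Nat.cast_zero]
      positivity
    · have h0 : idleProtocol.energy M G s m r v = 0 := by
        simp [Protocol.energy, idleProtocol]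
      have := hE Δ
      rw [h0, Nat.cast_zero]
      positivity
    · simp only [Nat.cast_one, one_pow, div_one, sub_self]
      unfold Protocol.successProb
      positivity

/-! ### The bounds for the three models. -/

theorem decay_pow_le {n : ℕ} (hn : 2 ≤ n) (c : ℕ) :
    ((63 : ℝ) / 64) ^ (64 * (c + 1) * (Nat.log 2 n + 1)) * n ≤ 1 / (n : ℝ) ^ c := by
  have hn0 : (0 : ℝ) < n := by positivity
  -- Each 64 rounds halve the potential. The extra 1 in `c + 1` pays for the factor `n`, which
  -- bounds the initial potential `F ≤ Δ < n` of the `CD` relay.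
  calc ((63 : ℝ) / 64) ^ (64 * (c + 1) * (Nat.log 2 n + 1)) * n
      = (((63 : ℝ) / 64) ^ 64) ^ ((c + 1) * (Nat.log 2 n + 1)) * n := by rw [← pow_mul, mul_assoc]
    _ ≤ ((1 : ℝ) / 2) ^ ((c + 1) * (Nat.log 2 n + 1)) * n := by
        refine mul_le_mul_of_nonneg_right ?_ hn0.le
        exact pow_le_pow_left₀ (by norm_num) (by norm_num) _
    _ ≤ 1 / (n : ℝ) ^ (c + 1) * n := mul_le_mul_of_nonneg_right (half_pow_log_le hn _) hn0.le
    _ = 1 / (n : ℝ) ^ c := by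
        rw [pow_succ]
        field_simp

theorem broadcastWHP_LOCAL : BroadcastWHP .LOCAL (fun n _ => (n : ℝ) * Real.log n)
    (fun n _ => Real.log n) := by
  classical
  -- `6 = 2 * 3`: a block has one relay round and one silent round, and 3 comes from
  -- `log_add_one_le`.
  refine broadcastWHP_of_relays _ _ _ (by simp) (by simp) fun c => ⟨6, by norm_num,
    fun _ _ => localRelay, fun n Δ hn _ _ => ⟨⟨0, 1, _, localRelay_works Δ, ?_⟩, ?_, 1, ?_, ?_⟩⟩
  · simp [localRelay]
  · have := log_add_one_le hn
    simp only [localRelay]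
    push_cast at this ⊢
    have hn0 : (0 : ℝ) ≤ n := Nat.cast_nonneg _
    nlinarith
  · exact card_act_le _ le_rfl fun l => (Finset.card_filter_le _ _).trans (by simp [localRelay])
  · have := log_add_one_le hn
    simp only [localRelay]
    push_cast at this ⊢
    linarith

/-- The factor `27 = 3 ^ 3` comes from replacing three binary logarithms by natural ones. -/
theorem slots_le {n Δ : ℕ} (hn : 2 ≤ n) (hΔ : 1 ≤ Δ) (c : ℕ) :
    ((n * (Nat.log 2 n + 1) * ((64 * (c + 1) * (Nat.log 2 n + 1) + 1) * (Nat.log 2 Δ + 1)) : ℕ) : ℝ)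
      ≤ 27 * (64 * c + 65) * ((n : ℝ) * Real.log ((Δ : ℝ) + 1) * Real.log n ^ 2) := by
  have hl := log_add_one_le hn
  have hK := log_add_one_le' hΔ
  have hlog : 0 ≤ Real.log ((Δ : ℝ) + 1) := Real.log_nonneg (by simp)
  have h1 : n * (Nat.log 2 n + 1) * ((64 * (c + 1) * (Nat.log 2 n + 1) + 1) * (Nat.log 2 Δ + 1)) ≤
      (64 * c + 65) * (n * ((Nat.log 2 Δ + 1) * (Nat.log 2 n + 1) ^ 2)) := by
    calc _ ≤ n * (Nat.log 2 n + 1) * (((64 * c + 65) * (Nat.log 2 n + 1)) * (Nat.log 2 Δ + 1)) := by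
          gcongr
          nlinarith
      _ = _ := by ring
  calc _ ≤ (((64 * c + 65) * (n * ((Nat.log 2 Δ + 1) * (Nat.log 2 n + 1) ^ 2)) : ℕ) : ℝ) := by
        exact_mod_cast h1
    _ = (64 * c + 65) * (n * (((Nat.log 2 Δ + 1 : ℕ) : ℝ) * ((Nat.log 2 n + 1 : ℕ) : ℝ) ^ 2)) := by
        push_cast; ring
    _ ≤ (64 * c + 65) * (n * ((3 * Real.log ((Δ : ℝ) + 1)) * (3 * Real.log n) ^ 2)) := by
        gcongr
    _ = _ := by ring

theorem broadcastWHP_CD : BroadcastWHP .CD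
    (fun n Δ => (n : ℝ) * Real.log (Δ + 1) * Real.log n ^ 2) (fun n _ => Real.log n ^ 2) := by
  classical
  refine broadcastWHP_of_relays _ _ _ (by simp) (by simp) fun c => ⟨27 * (64 * c + 65),
    by positivity, fun n Δ => walkRelay Δ (64 * (c + 1) * (Nat.log 2 n + 1)),
    fun n Δ hn hΔ hΔn => ⟨⟨63 / 64, Δ, _, walkRelay_works Δ _, ?_⟩, slots_le hn hΔ c, 1, ?_, ?_⟩⟩
  · refine le_trans ?_ (decay_pow_le hn c)
    refine mul_le_mul_of_nonneg_left ?_ (by positivity)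
    exact_mod_cast hΔn.le
  · refine card_act_le _ le_rfl fun l => Finset.card_le_one.2 fun i hi j hj => ?_
    simp only [walkRelay, Finset.mem_filter, decide_eq_true_eq] at hi hj
    rw [hi.2, hj.2]
  · have hl := log_add_one_le hn
    calc (((Nat.log 2 n + 1) * (64 * (c + 1) * (Nat.log 2 n + 1) * 1) : ℕ) : ℝ)
        = 64 * (c + 1) * ((Nat.log 2 n + 1 : ℕ) : ℝ) ^ 2 := by push_cast; ring
      _ ≤ 64 * (c + 1) * (3 * Real.log n) ^ 2 := by gcongr
      _ ≤ 27 * (64 * c + 65) * Real.log n ^ 2 := by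
          rw [mul_pow, ← mul_assoc]
          refine mul_le_mul_of_nonneg_right ?_ (by positivity)
          have : (0 : ℝ) ≤ c := Nat.cast_nonneg _
          linarith

theorem broadcastWHP_NoCD : BroadcastWHP .NoCD
    (fun n Δ => (n : ℝ) * Real.log (Δ + 1) * Real.log n ^ 2)
    (fun n Δ => Real.log (Δ + 1) * Real.log n ^ 2) := by
  classical
  refine broadcastWHP_of_relays _ _ _ (by simp) (by simp) fun c => ⟨27 * (64 * c + 65),
    by positivity, fun n Δ => decayRelay Δ (64 * (c + 1) * (Nat.log 2 n + 1)),
    fun n Δ hn hΔ hΔn => ⟨⟨63 / 64, 1, _, decayRelay_works Δ _, ?_⟩, slots_le hn hΔ c,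
      Nat.log 2 Δ + 1, ?_, ?_⟩⟩
  · refine le_trans ?_ (decay_pow_le hn c)
    refine mul_le_mul_of_nonneg_left ?_ (by positivity)
    exact_mod_cast (by omega : 1 ≤ n)
  · exact card_act_le _ (Nat.le_add_left 1 _) fun l => (Finset.card_filter_le _ _).trans
      (by simp [decayRelay])
  · have hl := log_add_one_le hn
    have hK := log_add_one_le' hΔ
    have hlog : 0 ≤ Real.log ((Δ : ℝ) + 1) := Real.log_nonneg (by simp)
    calc (((Nat.log 2 n + 1) * (64 * (c + 1) * (Nat.log 2 n + 1) * (Nat.log 2 Δ + 1)) : ℕ) : ℝ)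
        = 64 * (c + 1) * (((Nat.log 2 Δ + 1 : ℕ) : ℝ) * ((Nat.log 2 n + 1 : ℕ) : ℝ) ^ 2) := by
          push_cast; ring
      _ ≤ 64 * (c + 1) * ((3 * Real.log ((Δ : ℝ) + 1)) * (3 * Real.log n) ^ 2) := by gcongr
      _ = 27 * (64 * (c + 1)) * (Real.log ((Δ : ℝ) + 1) * Real.log n ^ 2) := by ring
      _ ≤ 27 * (64 * c + 65) * (Real.log ((Δ : ℝ) + 1) * Real.log n ^ 2) := by
          refine mul_le_mul_of_nonneg_right ?_ (by positivity)
          linarith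

end RadioNetwork


theorem mainTheorem4 :
    RadioNetwork.BroadcastWHP RadioNetwork.Model.LOCAL
      (fun n _ => (n : ℝ) * Real.log n)
      (fun n _ => Real.log n) ∧
    RadioNetwork.BroadcastWHP RadioNetwork.Model.CD
      (fun n Δ => (n : ℝ) * Real.log (Δ + 1) * Real.log n ^ 2)
      (fun n _ => Real.log n ^ 2) ∧
    RadioNetwork.BroadcastWHP RadioNetwork.Model.NoCD
      (fun n Δ => (n : ℝ) * Real.log (Δ + 1) * Real.log n ^ 2)
      (fun n Δ => Real.log (Δ + 1) * Real.log n ^ 2) :=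
  ⟨RadioNetwork.broadcastWHP_LOCAL, RadioNetwork.broadcastWHP_CD, RadioNetwork.broadcastWHP_NoCD⟩
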